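/- Let the infinite jet space have coordinates $\xi,\eta,w_{kl}$ $(k,l\in\mathbb N_0)$, where $w_{kl}$ stands for $\partial^{k+l}w/\partial\xi^k\partial\eta^l$ and $w_{00}=w$. Let $\mathcal D$ be a box in this space: a product of nonempty open intervals of $\mathbb R$ (bounded or not), one for each coordinate, where the intervals for the mixed derivatives $w_{kl}$, $k,l\ge1$, contain $0$. In particular, $\mathcal D$ may be the whole jet space. A differential function is a smooth real function on $\mathcal D$ of finitely many of the coordinates. The total derivatives are $\mathrm D_\xi=\partial_\xi+\sum_{k,l\ge0}w_{k+1,l}\,\partial_{w_{kl}}$ and $\mathrm D_\eta=\partial_\eta+\sum_{k,l\ge0}w_{k,l+1}\,\partial_{w_{kl}}$. Consider the light-cone wave equation $w_{\xi\eta}=0$. A differential function vanishes on solutions if it is zero at all points of $\mathcal D$ with $w_{kl}=0$ for all $k,l\ge1$, that is, where the equation and all its differential consequences hold. A conserved current is a pair $(F,G)$ of differential functions such that $\mathrm D_\xi F+\mathrm D_\eta G$ vanishes on solutions. A trivial current is a sum of a pair of differential functions both of which vanish on solutions and a pair $(F,G)$ of differential functions with $\mathrm D_\xi F+\mathrm D_\eta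 G=0$ identically on $\mathcal D$. The space of local conservation laws is the quotient of the space of conserved currents by the subspace of trivial currents. Let $V$ be the space of pairs $(F[w|\eta],G[w|\xi])$, where $F$ is a smooth function of $\eta$ and finitely many $w_{0l}$, $l\ge1$, and $G$ is a smooth function of $\xi$ and finitely many $w_{k0}$, $k\ge1$. Let $V_0$ be the subspace of trivial currents belonging to $V$. **Theorem.** All trivial currents and all elements of $V$ are conserved currents of $w_{\xi\eta}=0$. The space of local conservation laws of $w_{\xi\eta}=0$ is naturally isomorphic to $V/V_0$: the map that sends the class of $(F,G)\in V$ in $V/V_0$ to the conservation law represented by $(F,G)$ is a well-defined linear isomorphism. -/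

import Mathlib

open scoped ContDiff

noncomputable section

namespace LightConeWave

/-- Coordinates of the infinite jet space of functions `w (ξ, η)`: the independent variables
`ξ`, `η`, and the jet variables `w_{kl} = ∂^{k+l} w / ∂ξ^k ∂η^l`, with `w_{00} = w`. -/
inductive JetCoord : Type
  | xi : JetCoord
  | eta : JetCoord
  | w (k l : ℕ) : JetCoord
  deriving DecidableEq

/-- Points of the infinite jet space. -/
abbrev Jet : Type := JetCoord → ℝ

/-- The domain of the differential functions: a product of nonempty open intervals (bounded or
not), one for each jet coordinate, such that the intervals of the mixed derivatives `w_{kl}`,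
`k, l ≥ 1`, contain `0`, so that the domain meets the solution manifold of `w_{ξη} = 0`. -/
structure JetBox : Type where
  I : JetCoord → Set ℝ
  isOpen : ∀ c, IsOpen (I c)
  ordConnected : ∀ c, (I c).OrdConnected
  nonempty : ∀ c, (I c).Nonempty
  zero_mem : ∀ k l, (0 : ℝ) ∈ I (JetCoord.w (k + 1) (l + 1))

/-- The points of the jet space that lie in the box. -/
def JetBox.points (D : JetBox) : Set Jet := {j | ∀ c, j c ∈ D.I c}

/-- The whole jet space, as a box. -/
def JetBox.whole : JetBox where
  I := fun _ => Set.univ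
  isOpen := fun _ => isOpen_univ
  ordConnected := fun _ => Set.ordConnected_univ
  nonempty := fun _ => Set.univ_nonempty
  zero_mem := fun _ _ => Set.mem_univ _

variable (D : JetBox)

/-- `f` is a smooth function of the finitely many coordinates in `s`. -/
def SmoothIn (s : Finset JetCoord) (f : D.points → ℝ) : Prop :=
  ∃ g : (s → ℝ) → ℝ, ContDiffOn ℝ ∞ g (Set.univ.pi fun i : s => D.I i) ∧
    ∀ j : D.points, f j = g fun i => j.1 i

variable {D}

theorem SmoothIn.mono {s t : Finset JetCoord} (h : s ⊆ t) {f : D.points → ℝ}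
    (hf : SmoothIn D s f) : SmoothIn D t f := by
  obtain ⟨g, hg, hfg⟩ := hf
  refine ⟨fun x => g fun i => x ⟨i.1, h i.2⟩, ?_, hfg⟩
  refine hg.comp (t := Set.univ.pi fun i : s => D.I i)
    (f := fun (x : t → ℝ) (i : s) => x ⟨i.1, h i.2⟩) ?_ ?_
  · exact (contDiff_pi.2 fun i => contDiff_apply ℝ ℝ _).contDiffOn
  · intro x hx i _
    exact hx ⟨i.1, h i.2⟩ (Set.mem_univ _)

theorem SmoothIn.add {s : Finset JetCoord} {f₁ f₂ : D.points → ℝ}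
    (h₁ : SmoothIn D s f₁) (h₂ : SmoothIn D s f₂) : SmoothIn D s (f₁ + f₂) := by
  obtain ⟨g₁, hg₁, hf₁⟩ := h₁
  obtain ⟨g₂, hg₂, hf₂⟩ := h₂
  exact ⟨fun x => g₁ x + g₂ x, hg₁.add hg₂, fun j => by simp [hf₁ j, hf₂ j]⟩

theorem SmoothIn.smul {s : Finset JetCoord} {f : D.points → ℝ} (a : ℝ)
    (h : SmoothIn D s f) : SmoothIn D s (a • f) := by
  obtain ⟨g, hg, hf⟩ := h
  exact ⟨fun x => a * g x, contDiffOn_const.mul hg, fun j => by simp [hf j]⟩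

variable (D)

/-- The space of smooth functions on the box of finitely many of the coordinates in `A`. -/
def functionsOf (A : Set JetCoord) : Submodule ℝ (D.points → ℝ) where
  carrier := {f | ∃ s : Finset JetCoord, (s : Set JetCoord) ⊆ A ∧ SmoothIn D s f}
  add_mem' := by
    rintro f₁ f₂ ⟨s₁, hs₁, h₁⟩ ⟨s₂, hs₂, h₂⟩
    refine ⟨s₁ ∪ s₂, by simp [hs₁, hs₂], ?_⟩
    exact (h₁.mono Finset.subset_union_left).add (h₂.mono Finset.subset_union_right)
  zero_mem' := ⟨∅, by simp, fun _ => 0, contDiffOn_const, fun _ => rfl⟩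
  smul_mem' := by
    rintro a f ⟨s, hs, h⟩
    exact ⟨s, hs, h.smul a⟩

/-- Differential functions: smooth functions of finitely many jet coordinates. -/
def differentialFunctions : Submodule ℝ (D.points → ℝ) := functionsOf D Set.univ

variable {D}

/-- The partial derivative of `f` with respect to the coordinate `c`. The extension of `f` by zero
outside the box does not matter, since the box is open in the direction of `c`. -/
def pderiv (c : JetCoord) (f : D.points → ℝ) (j : D.points) : ℝ :=
  deriv (fun t : ℝ => Function.extend Subtype.val f 0 (Function.update j.1 c t)) (j.1 c)

/-- The total derivative `D_ξ = ∂_ξ + ∑_{k,l ≥ 0} w_{k+1,l} ∂_{w_{kl}}`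
(a finite sum for every differential function). -/
def totalXi (f : D.points → ℝ) (j : D.points) : ℝ :=
  pderiv JetCoord.xi f j +
    ∑ᶠ p : ℕ × ℕ, j.1 (JetCoord.w (p.1 + 1) p.2) * pderiv (JetCoord.w p.1 p.2) f j

/-- The total derivative `D_η = ∂_η + ∑_{k,l ≥ 0} w_{k,l+1} ∂_{w_{kl}}`
(a finite sum for every differential function). -/
def totalEta (f : D.points → ℝ) (j : D.points) : ℝ :=
  pderiv JetCoord.eta f j +
    ∑ᶠ p : ℕ × ℕ, j.1 (JetCoord.w p.1 (p.2 + 1)) * pderiv (JetCoord.w p.1 p.2) f j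

theorem eventually_mem (j : D.points) (c : JetCoord) :
    ∀ᶠ t in nhds (j.1 c), Function.update j.1 c t ∈ D.points := by
  filter_upwards [(D.isOpen c).mem_nhds (j.2 c)] with t ht d
  rcases eq_or_ne d c with rfl | h
  · simpa using ht
  · simpa [Function.update_of_ne h] using j.2 d

theorem extend_apply (f : D.points → ℝ) {x : Jet} (hx : x ∈ D.points) :
    Function.extend Subtype.val f 0 x = f ⟨x, hx⟩ :=
  Subtype.val_injective.extend_apply f 0 ⟨x, hx⟩

theorem SmoothIn.differentiableAt {s : Finset JetCoord} {f : D.points → ℝ} (h : SmoothIn D s f)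
    (c : JetCoord) (j : D.points) :
    DifferentiableAt ℝ
      (fun t : ℝ => Function.extend Subtype.val f 0 (Function.update j.1 c t)) (j.1 c) := by
  obtain ⟨g, hg, hf⟩ := h
  have h1 : DifferentiableAt ℝ (fun t : ℝ => g fun i : s => Function.update j.1 c t i)
      (j.1 c) := by
    have hop : IsOpen (Set.univ.pi fun i : s => D.I i) :=
      isOpen_set_pi Set.finite_univ fun i _ => D.isOpen i
    have hg' : DifferentiableAt ℝ g (fun i : s => Function.update j.1 c (j.1 c) i) := by
      refine (hg.contDiffAt (hop.mem_nhds ?_)).differentiableAt (by simp)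
      intro i _
      simpa using j.2 i
    refine DifferentiableAt.comp (j.1 c)
      (f := fun (t : ℝ) (i : s) => Function.update j.1 c t i) hg' ?_
    refine differentiableAt_pi.2 fun i => ?_
    by_cases hi : (i : JetCoord) = c
    · simp [hi]
    · simp [Function.update_of_ne hi]
  refine h1.congr_of_eventuallyEq ?_
  filter_upwards [eventually_mem j c] with t ht
  rw [extend_apply f ht, hf]

theorem SmoothIn.pderiv_eq_zero {s : Finset JetCoord} {f : D.points → ℝ} (h : SmoothIn D s f)
    {c : JetCoord} (hc : c ∉ s) (j : D.points) : pderiv c f j = 0 := by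
  obtain ⟨g, hg, hf⟩ := h
  have h1 : (fun t : ℝ => Function.extend Subtype.val f 0 (Function.update j.1 c t))
      =ᶠ[nhds (j.1 c)] fun _ => g fun i => j.1 i := by
    filter_upwards [eventually_mem j c] with t ht
    rw [extend_apply f ht, hf]
    congr 1
    funext i
    exact Function.update_of_ne (fun hi : (i : JetCoord) = c => hc (hi ▸ i.2)) _ _
  rw [pderiv, h1.deriv_eq, deriv_const]

theorem pderiv_add {f₁ f₂ : D.points → ℝ} (h₁ : f₁ ∈ differentialFunctions D)
    (h₂ : f₂ ∈ differentialFunctions D) (c : JetCoord) (j : D.points) :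
    pderiv c (f₁ + f₂) j = pderiv c f₁ j + pderiv c f₂ j := by
  obtain ⟨s₁, -, h₁⟩ := h₁
  obtain ⟨s₂, -, h₂⟩ := h₂
  rw [pderiv, pderiv, pderiv,
    ← deriv_add (h₁.differentiableAt c j) (h₂.differentiableAt c j)]
  refine Filter.EventuallyEq.deriv_eq ?_
  filter_upwards [eventually_mem j c] with t ht
  simp [extend_apply _ ht]

theorem pderiv_smul (a : ℝ) {f : D.points → ℝ} (h : f ∈ differentialFunctions D)
    (c : JetCoord) (j : D.points) : pderiv c (a • f) j = a * pderiv c f j := by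
  obtain ⟨s, -, h⟩ := h
  rw [pderiv, pderiv, ← deriv_const_mul a (h.differentiableAt c j)]
  refine Filter.EventuallyEq.deriv_eq ?_
  filter_upwards [eventually_mem j c] with t ht
  simp [extend_apply _ ht]

theorem finite_support {f : D.points → ℝ} (h : f ∈ differentialFunctions D)
    (j : D.points) (b : ℕ × ℕ → ℝ) :
    (Function.support fun p : ℕ × ℕ => b p * pderiv (JetCoord.w p.1 p.2) f j).Finite := by
  obtain ⟨s, -, h⟩ := h
  have hinj : Function.Injective fun p : ℕ × ℕ => JetCoord.w p.1 p.2 := by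
    rintro ⟨a, b⟩ ⟨c, d⟩ h
    simpa using h
  refine (s.finite_toSet.preimage hinj.injOn).subset fun p hp => ?_
  by_contra hps
  exact hp (by simp [h.pderiv_eq_zero (c := JetCoord.w p.1 p.2) hps j])

theorem totalXi_add {f₁ f₂ : D.points → ℝ} (h₁ : f₁ ∈ differentialFunctions D)
    (h₂ : f₂ ∈ differentialFunctions D) (j : D.points) :
    totalXi (f₁ + f₂) j = totalXi f₁ j + totalXi f₂ j := by
  simp only [totalXi, pderiv_add h₁ h₂, mul_add]
  rw [finsum_add_distrib (finite_support h₁ j _) (finite_support h₂ j _)]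
  ring

theorem totalEta_add {f₁ f₂ : D.points → ℝ} (h₁ : f₁ ∈ differentialFunctions D)
    (h₂ : f₂ ∈ differentialFunctions D) (j : D.points) :
    totalEta (f₁ + f₂) j = totalEta f₁ j + totalEta f₂ j := by
  simp only [totalEta, pderiv_add h₁ h₂, mul_add]
  rw [finsum_add_distrib (finite_support h₁ j _) (finite_support h₂ j _)]
  ring

theorem totalXi_smul (a : ℝ) {f : D.points → ℝ} (h : f ∈ differentialFunctions D)
    (j : D.points) : totalXi (a • f) j = a * totalXi f j := by
  simp only [totalXi, pderiv_smul a h, mul_left_comm _ a, mul_add]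
  rw [← mul_finsum]

theorem totalEta_smul (a : ℝ) {f : D.points → ℝ} (h : f ∈ differentialFunctions D)
    (j : D.points) : totalEta (a • f) j = a * totalEta f j := by
  simp only [totalEta, pderiv_smul a h, mul_left_comm _ a, mul_add]
  rw [← mul_finsum]

variable (D)

/-- Pairs `(F, G)` of differential functions. -/
def currents : Submodule ℝ ((D.points → ℝ) × (D.points → ℝ)) :=
  (differentialFunctions D).prod (differentialFunctions D)

variable {D}

/-- The total divergence `D_ξ F + D_η G`. -/
def divergence (P : (D.points → ℝ) × (D.points → ℝ)) (j : D.points) : ℝ :=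
  totalXi P.1 j + totalEta P.2 j

theorem divergence_add {P Q : (D.points → ℝ) × (D.points → ℝ)} (hP : P ∈ currents D)
    (hQ : Q ∈ currents D) (j : D.points) :
    divergence (P + Q) j = divergence P j + divergence Q j := by
  simp only [divergence, Prod.fst_add, Prod.snd_add, totalXi_add hP.1 hQ.1,
    totalEta_add hP.2 hQ.2]
  ring

theorem divergence_smul (a : ℝ) {P : (D.points → ℝ) × (D.points → ℝ)} (hP : P ∈ currents D)
    (j : D.points) : divergence (a • P) j = a * divergence P j := by
  simp only [divergence, Prod.smul_fst, Prod.smul_snd, totalXi_smul a hP.1,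
    totalEta_smul a hP.2]
  ring

theorem divergence_zero (j : D.points) :
    divergence (0 : (D.points → ℝ) × (D.points → ℝ)) j = 0 := by
  simpa using divergence_smul (0 : ℝ) (zero_mem (currents D)) j

variable (D)

/-- The solution manifold in the jet space: the equation `w_{ξη} = 0` together with all its
differential consequences `D_ξ^k D_η^l w_{11} = w_{k+1,l+1} = 0`. -/
def solutionManifold : Set D.points :=
  {j | ∀ k l : ℕ, j.1 (JetCoord.w (k + 1) (l + 1)) = 0}

/-- Currents that are divergence-free, `D_ξ F + D_η G = 0`, at all points of `S`. -/
def divergenceFreeOn (S : Set D.points) :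
    Submodule ℝ ((D.points → ℝ) × (D.points → ℝ)) where
  carrier := {P | P ∈ currents D ∧ ∀ j ∈ S, divergence P j = 0}
  add_mem' := by
    rintro P Q ⟨hP, hP'⟩ ⟨hQ, hQ'⟩
    exact ⟨add_mem hP hQ, fun j hj => by simp [divergence_add hP hQ, hP' j hj, hQ' j hj]⟩
  zero_mem' := ⟨zero_mem _, fun j _ => divergence_zero j⟩
  smul_mem' := by
    rintro a P ⟨hP, hP'⟩
    exact ⟨Submodule.smul_mem _ a hP, fun j hj => by simp [divergence_smul a hP, hP' j hj]⟩

/-- Conserved currents of `w_{ξη} = 0`: the divergence vanishes on solutions. -/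
def conservedCurrents : Submodule ℝ ((D.points → ℝ) × (D.points → ℝ)) :=
  divergenceFreeOn D (solutionManifold D)

/-- Null divergences: currents whose divergence vanishes identically. -/
def nullDivergences : Submodule ℝ ((D.points → ℝ) × (D.points → ℝ)) :=
  divergenceFreeOn D Set.univ

/-- Currents both of whose components vanish on solutions of `w_{ξη} = 0`. -/
def vanishingCurrents : Submodule ℝ ((D.points → ℝ) × (D.points → ℝ)) where
  carrier := {P | P ∈ currents D ∧ ∀ j ∈ solutionManifold D, P.1 j = 0 ∧ P.2 j = 0}
  add_mem' := by
    rintro P Q ⟨hP, hP'⟩ ⟨hQ, hQ'⟩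
    exact ⟨add_mem hP hQ, fun j hj => by simp [hP' j hj, hQ' j hj]⟩
  zero_mem' := ⟨zero_mem _, fun j _ => by simp⟩
  smul_mem' := by
    rintro a P ⟨hP, hP'⟩
    exact ⟨Submodule.smul_mem _ a hP, fun j hj => by simp [hP' j hj]⟩

/-- Trivial currents: sums of a current vanishing on solutions and a null divergence. -/
def trivialCurrents : Submodule ℝ ((D.points → ℝ) × (D.points → ℝ)) :=
  vanishingCurrents D ⊔ nullDivergences D

/-- The space of local conservation laws of `w_{ξη} = 0`: conserved currents modulo trivial
ones. -/
abbrev ConservationLaws : Type :=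
  conservedCurrents D ⧸ (trivialCurrents D).submoduleOf (conservedCurrents D)

/-- The space `V` of pairs `(F[w|η], G[w|ξ])`, where `F` is a smooth function of `η` and finitely
many `w_{0l}`, `l ≥ 1`, and `G` is a smooth function of `ξ` and finitely many `w_{k0}`, `k ≥ 1`. -/
def V : Submodule ℝ ((D.points → ℝ) × (D.points → ℝ)) :=
  (functionsOf D ({JetCoord.eta} ∪ {c | ∃ l : ℕ, 1 ≤ l ∧ c = JetCoord.w 0 l})).prod
    (functionsOf D ({JetCoord.xi} ∪ {c | ∃ k : ℕ, 1 ≤ k ∧ c = JetCoord.w k 0}))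

/-- The subspace `V₀` of the trivial currents belonging to `V`. -/
def V₀ : Submodule ℝ (V D) := (trivialCurrents D).submoduleOf (V D)

end LightConeWave

end

open scoped ContDiff

noncomputable section

-- Trivial currents and elements of `V` are conserved because, on the solution manifold, the total
-- derivatives are tangent to it and reduce to the commuting fields D̂_ξ = ∂_ξ + ∑ w_{k+1,0}
-- ∂_{w_{k0}} and D̂_η = ∂_η + ∑ w_{0,l+1} ∂_{w_{0l}}. Since `V₀` consists of all trivial currents
-- in `V`, injectivity is automatic; the content is that every conserved current (F, G) is
-- equivalent to a pair in `V`.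
--
-- Setting the mixed derivatives to zero changes (F, G) by a current vanishing on solutions, so F
-- and G may be taken to depend on ξ, η, w_{k0}, w_{0l} only, and then D̂_ξ F + D̂_η G = 0
-- identically. It suffices to find H with F + D̂_η H free of ξ, w and all w_{k0}, and G - D̂_ξ H
-- free of η and all w_{0l} (`exists_potential`): the pair (D̂_η H, -D̂_ξ H) agrees on solutions
-- with the null divergence (D_η H, -D_ξ H), hence is trivial (`solCurl_mem_trivialCurrents`).
--
-- H is built by induction on the largest m for which w_{m0} may occur. Let a = w_{m0}, m ≥ 1.
-- Comparing powers of w_{m+1,0} and differentiating twice by a gives ∂_a F = 0 and D̂_η ∂_a² G = 0.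
-- The kernel of D̂_η consists of the functions free of η and all w_{0l}
-- (`mem_functionsOf_of_solEta_eq_zero`). So, up to a function of ξ and the w_{k0}, k ≥ 1, G is
-- affine in a, and D̂_ξ of a w_{m-1,0}-primitive of the slope removes a. For m = 0 a ξ-primitive of
-- G serves as H (`exists_potential_zero`). Primitives exist, and vanishing partial derivatives mean
-- independence, because the box is a product of intervals.

universe u

/-! ### Smooth dependence of integrals on parameters -/

/-- Differentiation under the integral sign for a `C^1` integrand. -/
theorem hasFDerivAt_parametric_integral {E F : Type*} [NormedAddCommGroup E] [NormedSpace ℝ E]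
    [ProperSpace E] [NormedAddCommGroup F] [NormedSpace ℝ F] {U : Set E} (hU : IsOpen U)
    {W : Set (E × ℝ)} (hW : IsOpen W) (hUW : ∀ x ∈ U, ∀ t ∈ Set.Icc (0 : ℝ) 1, (x, t) ∈ W)
    {φ : E × ℝ → F} (hφ : ContDiffOn ℝ 1 φ W) {x₀ : E} (hx₀ : x₀ ∈ U) :
    HasFDerivAt (fun x => ∫ t in (0 : ℝ)..1, φ (x, t))
      (∫ t in (0 : ℝ)..1, (fderiv ℝ φ (x₀, t)).comp (ContinuousLinearMap.inl ℝ E ℝ)) x₀ := by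
  have line : ∀ x ∈ U, ContinuousOn (fun t => φ (x, t)) (Set.Icc 0 1) := fun x hx =>
    hφ.continuousOn.comp (by fun_prop) fun t ht => hUW x hx t ht
  obtain ⟨ε, hε, hball⟩ := Metric.nhds_basis_closedBall.mem_iff.1 (hU.mem_nhds hx₀)
  have hfd : ContinuousOn (fun p => (fderiv ℝ φ p).comp (ContinuousLinearMap.inl ℝ E ℝ)) W :=
    (hφ.continuousOn_fderiv_of_isOpen hW le_rfl).clm_comp continuousOn_const
  have hK : IsCompact (Metric.closedBall x₀ ε ×ˢ Set.Icc (0 : ℝ) 1) :=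
    (isCompact_closedBall x₀ ε).prod isCompact_Icc
  obtain ⟨C, hC⟩ := hK.exists_bound_of_continuousOn
    (hfd.mono fun p hp => hUW p.1 (hball hp.1) p.2 hp.2)
  have hsub : Set.uIoc (0 : ℝ) 1 ⊆ Set.Icc 0 1 := by
    rw [Set.uIoc_of_le zero_le_one]
    exact Set.Ioc_subset_Icc_self
  refine intervalIntegral.hasFDerivAt_integral_of_dominated_of_fderiv_le
    (F := fun x t => φ (x, t))
    (F' := fun x t => (fderiv ℝ φ (x, t)).comp (ContinuousLinearMap.inl ℝ E ℝ))
    (s := Metric.closedBall x₀ ε) (bound := fun _ => C)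
    (Metric.closedBall_mem_nhds x₀ hε) ?_ ?_ ?_ ?_ ?_ ?_
  · filter_upwards [hU.mem_nhds hx₀] with x hx
    exact ((line x hx).mono hsub).aestronglyMeasurable measurableSet_uIoc
  · refine ContinuousOn.intervalIntegrable ?_
    rw [Set.uIcc_of_le zero_le_one]
    exact line x₀ hx₀
  · refine ContinuousOn.aestronglyMeasurable ?_ measurableSet_uIoc
    exact hfd.comp (by fun_prop) fun t ht => hUW x₀ hx₀ t (hsub ht)
  · exact Filter.Eventually.of_forall fun t ht x hx => hC (x, t) ⟨hx, hsub ht⟩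
  · exact intervalIntegrable_const
  · refine Filter.Eventually.of_forall fun t ht x hx => ?_
    have h1 : HasFDerivAt φ (fderiv ℝ φ (x, t)) (x, t) :=
      ((hφ.differentiableOn one_ne_zero).differentiableAt
        (hW.mem_nhds (hUW x (hball hx) t (hsub ht)))).hasFDerivAt
    exact h1.comp x (hasFDerivAt_prodMk_left x t)

/-- Parametric integrals of `C^{n+1}` functions are `C^n`. -/
theorem contDiffOn_parametric_integral_nat {E : Type u} [NormedAddCommGroup E] [NormedSpace ℝ E]
    [ProperSpace E] {U : Set E} (hU : IsOpen U) {W : Set (E × ℝ)} (hW : IsOpen W)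
    (hUW : ∀ x ∈ U, ∀ t ∈ Set.Icc (0 : ℝ) 1, (x, t) ∈ W) (n : ℕ)
    {F : Type u} [NormedAddCommGroup F] [NormedSpace ℝ F] {φ : E × ℝ → F}
    (hφ : ContDiffOn ℝ (n + 1) φ W) :
    ContDiffOn ℝ n (fun x => ∫ t in (0 : ℝ)..1, φ (x, t)) U := by
  have deriv_at := fun x (hx : x ∈ U) =>
    hasFDerivAt_parametric_integral hU hW hUW (hφ.of_le (by simp)) hx
  -- The derivative takes values in `E →L[ℝ] F`, so the codomain has to vary; this is why `E` and
  -- `F` share a universe.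
  induction n generalizing F with
  | zero =>
    exact contDiffOn_zero.2 fun x hx => (deriv_at x hx).continuousAt.continuousWithinAt
  | succ n ih =>
    rw [show ((n + 1 : ℕ) : WithTop ℕ∞) = (n : WithTop ℕ∞) + 1 by push_cast; rfl,
      contDiffOn_succ_iff_fderiv_of_isOpen hU]
    refine ⟨fun x hx => (deriv_at x hx).differentiableAt.differentiableWithinAt, by simp, ?_⟩
    have hfd : ContDiffOn ℝ (n + 1)
        (fun p => (fderiv ℝ φ p).comp (ContinuousLinearMap.inl ℝ E ℝ)) W :=
      (hφ.fderiv_of_isOpen hW (by push_cast; rfl)).clm_comp contDiffOn_const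
    exact (ih hfd fun x hx => hasFDerivAt_parametric_integral hU hW hUW
      (hfd.of_le (by simp)) hx).congr fun x hx => (deriv_at x hx).fderiv

/-- Parametric integrals of smooth functions are smooth. -/
theorem contDiffOn_parametric_integral {E F : Type u} [NormedAddCommGroup E] [NormedSpace ℝ E]
    [ProperSpace E] [NormedAddCommGroup F] [NormedSpace ℝ F] {U : Set E} (hU : IsOpen U)
    {W : Set (E × ℝ)} (hW : IsOpen W) (hUW : ∀ x ∈ U, ∀ t ∈ Set.Icc (0 : ℝ) 1, (x, t) ∈ W)
    {φ : E × ℝ → F} (hφ : ContDiffOn ℝ ∞ φ W) :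
    ContDiffOn ℝ ∞ (fun x => ∫ t in (0 : ℝ)..1, φ (x, t)) U :=
  contDiffOn_infty.2 fun n => contDiffOn_parametric_integral_nat hU hW hUW n
    (hφ.of_le (by exact_mod_cast le_top))

namespace LightConeWave

variable {D : JetBox}

/-! ### Calculus of partial derivatives on the box -/

theorem isOpen_box (D : JetBox) (s : Finset JetCoord) :
    IsOpen (Set.univ.pi fun i : s => D.I i) :=
  isOpen_set_pi Set.finite_univ fun i _ => D.isOpen i

/-- The point of the box with the coordinate `c` replaced by `t`. -/
def replaceCoord (j : D.points) (c : JetCoord) (t : ℝ) (ht : t ∈ D.I c) : D.points :=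
  ⟨Function.update j.1 c t, fun d => by
    rcases eq_or_ne d c with rfl | h
    · simpa using ht
    · simpa [Function.update_of_ne h] using j.2 d⟩

theorem extend_update (f : D.points → ℝ) (j : D.points) (c : JetCoord) (t : ℝ)
    (ht : t ∈ D.I c) :
    Function.extend Subtype.val f 0 (Function.update j.1 c t) = f (replaceCoord j c t ht) :=
  extend_apply f (replaceCoord j c t ht).2

theorem restrict_update {s : Finset JetCoord} {c : JetCoord} (hc : c ∈ s) (x : Jet) (t : ℝ) :
    (fun i : s => Function.update x c t i) = Function.update (fun i : s => x i) ⟨c, hc⟩ t := by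
  funext i
  by_cases hi : i = ⟨c, hc⟩
  · subst hi
    simp
  · have : (i : JetCoord) ≠ c := fun h => hi (Subtype.ext h)
    simp [Function.update_of_ne hi, Function.update_of_ne this]

theorem hasDerivAt_line {s : Finset JetCoord} {f : D.points → ℝ} {g : (s → ℝ) → ℝ}
    (hg : ContDiffOn ℝ ∞ g (Set.univ.pi fun i : s => D.I i))
    (hf : ∀ j : D.points, f j = g fun i => j.1 i) {c : JetCoord} (hc : c ∈ s) (j : D.points) :
    HasDerivAt (fun t : ℝ => Function.extend Subtype.val f 0 (Function.update j.1 c t))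
      (fderiv ℝ g (fun i => j.1 i) (Pi.single ⟨c, hc⟩ 1)) (j.1 c) := by
  have hmem : (fun i : s => j.1 i) ∈ Set.univ.pi fun i : s => D.I i := fun i _ => j.2 i
  have hd : HasFDerivAt g (fderiv ℝ g (fun i => j.1 i))
      (Function.update (fun i : s => j.1 i) ⟨c, hc⟩ (j.1 c)) := by
    rw [← restrict_update hc, Function.update_eq_self]
    exact ((hg.contDiffAt ((isOpen_box D s).mem_nhds hmem)).differentiableAt
      (by simp)).hasFDerivAt
  refine (hd.comp_hasDerivAt (j.1 c)
    (hasDerivAt_update (fun i : s => j.1 i) ⟨c, hc⟩ (j.1 c))).congr_of_eventuallyEq ?_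
  filter_upwards [eventually_mem j c] with t ht
  rw [extend_apply f ht, hf, Function.comp_apply, ← restrict_update hc]

theorem pderiv_eq_fderiv {s : Finset JetCoord} {f : D.points → ℝ} {g : (s → ℝ) → ℝ}
    (hg : ContDiffOn ℝ ∞ g (Set.univ.pi fun i : s => D.I i))
    (hf : ∀ j : D.points, f j = g fun i => j.1 i) {c : JetCoord} (hc : c ∈ s) (j : D.points) :
    pderiv c f j = fderiv ℝ g (fun i => j.1 i) (Pi.single ⟨c, hc⟩ 1) :=
  (hasDerivAt_line hg hf hc j).deriv

theorem SmoothIn.zero (s : Finset JetCoord) : SmoothIn D s 0 :=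
  ⟨fun _ => 0, contDiffOn_const, fun _ => rfl⟩

theorem contDiffOn_fderiv_apply {E F : Type*} [NormedAddCommGroup E] [NormedSpace ℝ E]
    [NormedAddCommGroup F] [NormedSpace ℝ F] {g : E → F} {U : Set E} (hU : IsOpen U)
    (hg : ContDiffOn ℝ ∞ g U) (v : E) : ContDiffOn ℝ ∞ (fun x => fderiv ℝ g x v) U :=
  (hg.fderiv_of_isOpen hU (by simp)).clm_apply contDiffOn_const

theorem SmoothIn.pderiv {s : Finset JetCoord} {f : D.points → ℝ} (h : SmoothIn D s f)
    (c : JetCoord) : SmoothIn D s (pderiv c f) := by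
  by_cases hc : c ∈ s
  · obtain ⟨g, hg, hf⟩ := h
    exact ⟨_, contDiffOn_fderiv_apply (isOpen_box D s) hg _, pderiv_eq_fderiv hg hf hc⟩
  · rw [show LightConeWave.pderiv c f = 0 from funext (h.pderiv_eq_zero hc)]
    exact SmoothIn.zero s

theorem SmoothIn.mul {s : Finset JetCoord} {f₁ f₂ : D.points → ℝ}
    (h₁ : SmoothIn D s f₁) (h₂ : SmoothIn D s f₂) : SmoothIn D s (f₁ * f₂) := by
  obtain ⟨g₁, hg₁, hf₁⟩ := h₁
  obtain ⟨g₂, hg₂, hf₂⟩ := h₂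
  exact ⟨fun x => g₁ x * g₂ x, hg₁.mul hg₂, fun j => by simp [hf₁ j, hf₂ j]⟩

theorem SmoothIn.mem_functionsOf {s : Finset JetCoord} {f : D.points → ℝ} (h : SmoothIn D s f)
    {A : Set JetCoord} (hs : (s : Set JetCoord) ⊆ A) : f ∈ functionsOf D A := ⟨s, hs, h⟩

theorem functionsOf_mono {A B : Set JetCoord} (h : A ⊆ B) : functionsOf D A ≤ functionsOf D B :=
  fun _ ⟨s, hs, hf⟩ => ⟨s, hs.trans h, hf⟩

theorem functionsOf_le {A : Set JetCoord} : functionsOf D A ≤ differentialFunctions D :=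
  functionsOf_mono (Set.subset_univ A)

theorem mul_mem_functionsOf {A : Set JetCoord} {f₁ f₂ : D.points → ℝ}
    (h₁ : f₁ ∈ functionsOf D A) (h₂ : f₂ ∈ functionsOf D A) : f₁ * f₂ ∈ functionsOf D A := by
  obtain ⟨s₁, hs₁, h₁⟩ := h₁
  obtain ⟨s₂, hs₂, h₂⟩ := h₂
  exact ⟨s₁ ∪ s₂, by simp [hs₁, hs₂],
    (h₁.mono Finset.subset_union_left).mul (h₂.mono Finset.subset_union_right)⟩

theorem pderiv_mem_functionsOf {A : Set JetCoord} {f : D.points → ℝ} (h : f ∈ functionsOf D A)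
    (c : JetCoord) : pderiv c f ∈ functionsOf D A := by
  obtain ⟨s, hs, h⟩ := h
  exact ⟨s, hs, h.pderiv c⟩

theorem const_mem_functionsOf (A : Set JetCoord) (a : ℝ) :
    (fun _ => a : D.points → ℝ) ∈ functionsOf D A :=
  ⟨∅, by simp, fun _ => a, contDiffOn_const, fun _ => rfl⟩

theorem coord_mem_functionsOf {A : Set JetCoord} {c : JetCoord} (hc : c ∈ A) :
    (fun j => j.1 c : D.points → ℝ) ∈ functionsOf D A :=
  ⟨{c}, by simpa using hc, fun x => x ⟨c, by simp⟩, (contDiff_apply ℝ ℝ _).contDiffOn,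
    fun _ => rfl⟩

theorem pderiv_eq_zero_of_notMem {A : Set JetCoord} {f : D.points → ℝ}
    (h : f ∈ functionsOf D A) {c : JetCoord} (hc : c ∉ A) : pderiv c f = 0 := by
  obtain ⟨s, hs, h⟩ := h
  exact funext (h.pderiv_eq_zero fun hcs => hc (hs hcs))

theorem pderiv_zero (c : JetCoord) : pderiv c (0 : D.points → ℝ) = 0 :=
  pderiv_eq_zero_of_notMem (A := ∅) (zero_mem _) (Set.notMem_empty c)

theorem pderiv_const (c : JetCoord) (a : ℝ) : pderiv c (fun _ => a : D.points → ℝ) = 0 :=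
  pderiv_eq_zero_of_notMem (const_mem_functionsOf ∅ a) (Set.notMem_empty c)

theorem pderiv_coord (c d : JetCoord) :
    pderiv c (fun j => j.1 d : D.points → ℝ) = fun _ => if d = c then 1 else 0 := by
  split_ifs with h
  · subst h
    funext j
    have : (fun t : ℝ => Function.extend Subtype.val (fun j : D.points => j.1 d) 0
        (Function.update j.1 d t)) =ᶠ[nhds (j.1 d)] id := by
      filter_upwards [eventually_mem j d] with t ht
      rw [extend_apply _ ht]
      simp
    rw [pderiv, this.deriv_eq, deriv_id]
  · exact pderiv_eq_zero_of_notMem (coord_mem_functionsOf (Set.mem_singleton d)) (Ne.symm h)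

theorem differentiableAt_line {f : D.points → ℝ} (h : f ∈ differentialFunctions D)
    (c : JetCoord) (j : D.points) :
    DifferentiableAt ℝ
      (fun t : ℝ => Function.extend Subtype.val f 0 (Function.update j.1 c t)) (j.1 c) := by
  obtain ⟨s, -, h⟩ := h
  exact h.differentiableAt c j

theorem pderiv_add' {f₁ f₂ : D.points → ℝ} (h₁ : f₁ ∈ differentialFunctions D)
    (h₂ : f₂ ∈ differentialFunctions D) (c : JetCoord) :
    pderiv c (f₁ + f₂) = pderiv c f₁ + pderiv c f₂ :=
  funext (pderiv_add h₁ h₂ c)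

theorem pderiv_sub {f₁ f₂ : D.points → ℝ} (h₁ : f₁ ∈ differentialFunctions D)
    (h₂ : f₂ ∈ differentialFunctions D) (c : JetCoord) :
    pderiv c (f₁ - f₂) = pderiv c f₁ - pderiv c f₂ := by
  have h := pderiv_add' (sub_mem h₁ h₂) h₂ c
  rw [sub_add_cancel] at h
  exact eq_sub_of_add_eq h.symm

theorem pderiv_mul {f₁ f₂ : D.points → ℝ} (h₁ : f₁ ∈ differentialFunctions D)
    (h₂ : f₂ ∈ differentialFunctions D) (c : JetCoord) :
    pderiv c (f₁ * f₂) = pderiv c f₁ * f₂ + f₁ * pderiv c f₂ := by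
  funext j
  have hu : Function.update j.1 c (j.1 c) ∈ D.points := by simp
  have h := ((differentiableAt_line h₁ c j).hasDerivAt.mul
    (differentiableAt_line h₂ c j).hasDerivAt)
  rw [extend_apply _ hu, extend_apply _ hu] at h
  have hj : (⟨_, hu⟩ : D.points) = j := Subtype.ext (Function.update_eq_self c j.1)
  rw [hj] at h
  refine (h.congr_of_eventuallyEq ?_).deriv
  filter_upwards [eventually_mem j c] with t ht
  simp [extend_apply _ ht]

theorem pderiv_sum {ι : Type*} (s : Finset ι) {f : ι → D.points → ℝ}
    (h : ∀ i ∈ s, f i ∈ differentialFunctions D) (c : JetCoord) :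
    pderiv c (∑ i ∈ s, f i) = ∑ i ∈ s, pderiv c (f i) := by
  classical
  induction s using Finset.induction_on with
  | empty => simp [pderiv_zero]
  | insert a s ha ih =>
    have h' : ∀ i ∈ s, f i ∈ differentialFunctions D := fun i hi =>
      h i (Finset.mem_insert_of_mem hi)
    rw [Finset.sum_insert ha, Finset.sum_insert ha,
      pderiv_add' (h a (Finset.mem_insert_self a s)) (sum_mem h'), ih h']

theorem pderiv_comm {f : D.points → ℝ} (h : f ∈ differentialFunctions D) (c d : JetCoord) :
    pderiv c (pderiv d f) = pderiv d (pderiv c f) := by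
  obtain ⟨s, -, h⟩ := h
  -- The coordinates are enlarged by `c` and `d`, so that both partial derivatives are directional
  -- derivatives of one `g`.
  obtain ⟨g, hg, hf⟩ := h.mono (Finset.subset_union_left (s₂ := {c, d}))
  generalize ht : s ∪ {c, d} = t at g hg hf
  have hc : c ∈ t := by simp [← ht]
  have hd : d ∈ t := by simp [← ht]
  have second : ∀ {a b : JetCoord} (ha : a ∈ t) (hb : b ∈ t) (j : D.points),
      pderiv a (pderiv b f) j = fderiv ℝ (fderiv ℝ g) (fun i => j.1 i)
        (Pi.single ⟨a, ha⟩ 1) (Pi.single ⟨b, hb⟩ 1) := by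
    intro a b ha hb j
    rw [pderiv_eq_fderiv (contDiffOn_fderiv_apply (isOpen_box D t) hg _)
      (pderiv_eq_fderiv hg hf hb) ha]
    have hmem : (fun i : t => j.1 i) ∈ Set.univ.pi fun i : t => D.I i := fun i _ => j.2 i
    have hd2 : DifferentiableAt ℝ (fderiv ℝ g) (fun i : t => j.1 i) :=
      ((hg.fderiv_of_isOpen (m := ∞) (isOpen_box D t) (by simp)).contDiffAt
        ((isOpen_box D t).mem_nhds hmem)).differentiableAt (by simp)
    rw [fderiv_clm_apply hd2 (differentiableAt_const _)]
    simp
  funext j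
  rw [second hc hd, second hd hc]
  have hmem : (fun i : t => j.1 i) ∈ Set.univ.pi fun i : t => D.I i := fun i _ => j.2 i
  exact ((hg.contDiffAt ((isOpen_box D t).mem_nhds hmem)).isSymmSndFDerivAt
    (by rw [minSmoothness_of_isRCLikeNormedField]; exact WithTop.coe_le_coe.2 le_top)) _ _

/-! ### Freezing coordinates and discarding irrelevant ones -/

/-- A base point of the box, at which the mixed derivatives vanish. -/
def basePoint (D : JetBox) : D.points :=
  ⟨fun c => match c with
    | .w (_ + 1) (_ + 1) => 0
    | c => (D.nonempty c).some, by
      rintro (_ | _ | ⟨_ | k, _ | l⟩)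
      all_goals first | exact D.zero_mem _ _ | exact (D.nonempty _).some_mem⟩

open Classical in
/-- The coordinates in `B` are moved to the base point. -/
def freeze (B : Set JetCoord) (j : D.points) : D.points :=
  ⟨fun c => if c ∈ B then (basePoint D).1 c else j.1 c, fun c => by
    by_cases hc : c ∈ B
    · simpa only [hc, if_true] using (basePoint D).2 c
    · simpa only [hc, if_false] using j.2 c⟩

theorem freeze_of_mem {B : Set JetCoord} {c : JetCoord} (hc : c ∈ B) (j : D.points) :
    (freeze B j).1 c = (basePoint D).1 c := if_pos hc

theorem freeze_of_notMem {B : Set JetCoord} {c : JetCoord} (hc : c ∉ B) (j : D.points) :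
    (freeze B j).1 c = j.1 c := if_neg hc

theorem comp_freeze_mem_functionsOf {A : Set JetCoord} (B : Set JetCoord) {f : D.points → ℝ}
    (h : f ∈ functionsOf D A) : (fun j => f (freeze B j)) ∈ functionsOf D (A \ B) := by
  classical
  obtain ⟨s, hs, g, hg, hf⟩ := h
  refine ⟨s.filter (· ∉ B), fun c hc => ?_, fun x => g fun i =>
    if hi : i.1 ∈ B then (basePoint D).1 i else x ⟨i.1, by simp [hi]⟩, ?_, fun j => ?_⟩
  · have := Finset.mem_filter.1 hc
    exact ⟨hs this.1, this.2⟩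
  · refine hg.comp (ContDiff.contDiffOn (contDiff_pi.2 fun i => ?_)) fun x hx i _ => ?_
    · by_cases hi : i.1 ∈ B
      · simp only [hi, dite_true]
        exact contDiff_const
      · simp only [hi, dite_false]
        exact contDiff_apply ℝ ℝ _
    · by_cases hi : i.1 ∈ B
      · simp only [hi, dite_true]
        exact (basePoint D).2 i
      · simp only [hi, dite_false]
        exact hx ⟨i.1, by simp [hi]⟩ (Set.mem_univ _)
  · change f (freeze B j) = _
    rw [hf]
    congr 1

theorem eq_of_eqOn {A : Set JetCoord} {f : D.points → ℝ} (h : f ∈ functionsOf D A)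
    {j j' : D.points} (hj : ∀ c ∈ A, j.1 c = j'.1 c) : f j = f j' := by
  obtain ⟨s, hs, g, -, hf⟩ := h
  rw [hf, hf]
  congr 1
  funext i
  exact hj i (hs i.2)

theorem hasDerivAt_line_of_mem {f : D.points → ℝ} (h : f ∈ differentialFunctions D)
    (c : JetCoord) (j : D.points) :
    ∀ t ∈ D.I c, HasDerivAt
      (fun t : ℝ => Function.extend Subtype.val f 0 (Function.update j.1 c t))
      (Function.extend Subtype.val (pderiv c f) 0 (Function.update j.1 c t)) t := by
  intro t ht
  have h1 := (differentiableAt_line h c (replaceCoord j c t ht)).hasDerivAt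
  rw [extend_update _ j c t ht]
  simpa [replaceCoord, pderiv] using h1

/-- The slice of the box through `j` in the direction `c` is an interval, hence connected. -/
theorem eq_replaceCoord_of_pderiv_eq_zero {f : D.points → ℝ} (h : f ∈ differentialFunctions D)
    {c : JetCoord} (hc : pderiv c f = 0) (j : D.points) (t : ℝ) (ht : t ∈ D.I c) :
    f j = f (replaceCoord j c t ht) := by
  have hd := hasDerivAt_line_of_mem h c j
  have h1 := (D.isOpen c).is_const_of_fderiv_eq_zero (𝕜 := ℝ) (D.ordConnected c).isPreconnected
    (fun t ht => (hd t ht).differentiableAt.differentiableWithinAt) (fun t ht => by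
      ext
      rw [fderiv_eq_smul_deriv, (hd t ht).deriv, extend_update _ j c t ht, hc]
      simp) (j.2 c) ht
  simp only [Function.update_eq_self] at h1
  rwa [extend_apply f j.2, extend_update f j c t ht] at h1

theorem mem_functionsOf_diff_singleton {A : Set JetCoord} {f : D.points → ℝ}
    (h : f ∈ functionsOf D A) {c : JetCoord} (hc : pderiv c f = 0) :
    f ∈ functionsOf D (A \ {c}) := by
  convert comp_freeze_mem_functionsOf {c} h using 1
  funext j
  rw [eq_replaceCoord_of_pderiv_eq_zero (functionsOf_le h) hc j _ ((basePoint D).2 c)]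
  congr 1
  ext d
  by_cases hd : d = c
  · subst hd
    simp [replaceCoord, freeze_of_mem (Set.mem_singleton d)]
  · rw [freeze_of_notMem (by simpa using hd)]
    simp [replaceCoord, Function.update_of_ne hd]

theorem mem_functionsOf_diff {A B : Set JetCoord} {f : D.points → ℝ}
    (h : f ∈ functionsOf D A) (hB : ∀ c ∈ B, pderiv c f = 0) :
    f ∈ functionsOf D (A \ B) := by
  classical
  obtain ⟨s, hs, hf⟩ := h
  -- `B` may be infinite, but only its finitely many members in `s` matter; they are removed one at
  -- a time.
  have key : ∀ t : Finset JetCoord, (∀ c ∈ t, c ∈ B) →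
      f ∈ functionsOf D ((s : Set JetCoord) \ t) := by
    intro t
    induction t using Finset.induction_on with
    | empty => exact fun _ => hf.mem_functionsOf (by simp)
    | insert a t ha ih =>
      intro ht
      have := mem_functionsOf_diff_singleton
        (ih fun c hc => ht c (Finset.mem_insert_of_mem hc))
        (hB a (ht a (Finset.mem_insert_self a t)))
      refine functionsOf_mono (fun c hc => ?_) this
      simp only [Finset.coe_insert, Set.mem_sdiff, Set.mem_insert_iff, not_or] at hc ⊢
      tauto
  have h := key (s.filter (· ∈ B)) fun c hc => (Finset.mem_filter.1 hc).2
  refine functionsOf_mono (fun c hc => ?_) h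
  simp only [Finset.coe_filter, Set.mem_sdiff, Set.mem_ofPred_eq] at hc ⊢
  exact ⟨hs hc.1, fun hcB => hc.2 ⟨hc.1, hcB⟩⟩

/-! ### Primitives in one coordinate -/

/-- The primitive of `f` with respect to the coordinate `c` that vanishes at the base point. -/
def primitive (c : JetCoord) (f : D.points → ℝ) (j : D.points) : ℝ :=
  ∫ t in (basePoint D).1 c..j.1 c,
    Function.extend Subtype.val f 0 (Function.update j.1 c t)

/-- The substitution u = b + (x_c - b)t moves the variable endpoint into the integrand, leaving a
parametric integral over [0, 1]. Convexity of the interval keeps the segment inside the box. -/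
theorem SmoothIn.primitive {s : Finset JetCoord} {f : D.points → ℝ} (h : SmoothIn D s f)
    {c : JetCoord} (hc : c ∈ s) : SmoothIn D s (primitive c f) := by
  obtain ⟨g, hg, hf⟩ := h
  set b := (basePoint D).1 c with hb
  let ψ : (s → ℝ) × ℝ → s → ℝ := fun p =>
    Function.update p.1 ⟨c, hc⟩ (b + (p.1 ⟨c, hc⟩ - b) * p.2)
  have hψ : ContDiff ℝ ∞ ψ := by
    refine contDiff_pi.2 fun i => ?_
    by_cases hi : i = ⟨c, hc⟩
    · subst hi
      simp only [ψ, Function.update_self]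
      fun_prop
    · simp only [ψ, Function.update_of_ne hi]
      fun_prop
  have hsub : ∀ x ∈ Set.univ.pi fun i : s => D.I i, ∀ t ∈ Set.Icc (0 : ℝ) 1,
      (x, t) ∈ ψ ⁻¹' Set.univ.pi fun i : s => D.I i := by
    intro x hx t ht i _
    by_cases hi : i = ⟨c, hc⟩
    · subst hi
      simp only [ψ, Function.update_self]
      have := (D.ordConnected c).convex.add_smul_sub_mem ((basePoint D).2 c)
        (hx ⟨c, hc⟩ (Set.mem_univ _)) ht
      rwa [smul_eq_mul, mul_comm] at this
    · simpa only [ψ, Function.update_of_ne hi] using hx i (Set.mem_univ _)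
  have hφ : ContDiffOn ℝ ∞ (g ∘ ψ) (ψ ⁻¹' Set.univ.pi fun i : s => D.I i) :=
    hg.comp hψ.contDiffOn fun p hp => hp
  refine ⟨fun x => (x ⟨c, hc⟩ - b) * ∫ t in (0 : ℝ)..1, (g ∘ ψ) (x, t), ?_, fun j => ?_⟩
  · exact ContDiffOn.mul (by fun_prop) (contDiffOn_parametric_integral (isOpen_box D s)
      ((isOpen_box D s).preimage hψ.continuous) hsub hφ)
  · have h1 := intervalIntegral.mul_integral_comp_add_mul (a := 0) (b := 1)
      (f := fun u => g (Function.update (fun i : s => j.1 i) ⟨c, hc⟩ u)) (j.1 c - b) b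
    simp only [mul_zero, add_zero, mul_one, add_sub_cancel] at h1
    refine Eq.trans ?_ h1.symm
    refine intervalIntegral.integral_congr fun t ht => ?_
    have ht' : t ∈ D.I c := (D.ordConnected c).uIcc_subset ((basePoint D).2 c) (j.2 c) ht
    rw [extend_update f j c t ht', hf, ← restrict_update hc]
    rfl

theorem pderiv_primitive {f : D.points → ℝ} (h : f ∈ differentialFunctions D)
    (c : JetCoord) : pderiv c (primitive c f) = f := by
  funext j
  have hd := hasDerivAt_line_of_mem h c j
  have hcont : ContinuousOn
      (fun t : ℝ => Function.extend Subtype.val f 0 (Function.update j.1 c t)) (D.I c) :=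
    fun t ht => (hd t ht).continuousAt.continuousWithinAt
  have hsub := (D.ordConnected c).uIcc_subset ((basePoint D).2 c) (j.2 c)
  have h1 := intervalIntegral.integral_hasDerivAt_right
    (hcont.mono hsub).intervalIntegrable
    (hcont.stronglyMeasurableAtFilter (D.isOpen c) _ (j.2 c)) (hd _ (j.2 c)).continuousAt
  rw [Function.update_eq_self, extend_apply f j.2] at h1
  refine (h1.congr_of_eventuallyEq ?_).deriv
  filter_upwards [eventually_mem j c] with t ht
  rw [extend_apply _ ht]
  simp [primitive]

theorem primitive_mem_functionsOf {A : Set JetCoord} {f : D.points → ℝ}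
    (h : f ∈ functionsOf D A) {c : JetCoord} (hc : c ∈ A) : primitive c f ∈ functionsOf D A := by
  obtain ⟨s, hs, h⟩ := h
  exact ⟨insert c s, by simp [Set.insert_subset_iff, hs, hc],
    (h.mono (Finset.subset_insert c s)).primitive (Finset.mem_insert_self c s)⟩

theorem primitive_eq_zero (f : D.points → ℝ) {c : JetCoord} {j : D.points}
    (hj : j.1 c = (basePoint D).1 c) : primitive c f j = 0 := by
  simp [primitive, hj]

/-- Moving the coordinate `d` stays inside the slice where `c` has the value `b`. -/
theorem pderiv_eq_zero_of_vanishing {f : D.points → ℝ} {c d : JetCoord} (hcd : c ≠ d) {b : ℝ}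
    (hf : ∀ j : D.points, j.1 c = b → f j = 0) {j : D.points} (hj : j.1 c = b) :
    pderiv d f j = 0 := by
  have : (fun t : ℝ => Function.extend Subtype.val f 0 (Function.update j.1 d t))
      =ᶠ[nhds (j.1 d)] fun _ => 0 := by
    filter_upwards [eventually_mem j d] with t ht
    rw [extend_apply f ht]
    exact hf _ (by simpa [Function.update_of_ne hcd] using hj)
  rw [pderiv, this.deriv_eq, deriv_const]

theorem eq_zero_of_pderiv_eq_zero {f : D.points → ℝ} (h : f ∈ differentialFunctions D)
    {c : JetCoord} (hc : pderiv c f = 0)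
    (hf : ∀ j : D.points, j.1 c = (basePoint D).1 c → f j = 0) : f = 0 := by
  funext j
  rw [eq_replaceCoord_of_pderiv_eq_zero h hc j _ ((basePoint D).2 c)]
  exact hf _ (by simp [replaceCoord])

/-! ### Vector fields on the box and their commutation -/

/-- The vector field with coefficients `A c`, acting on functions on the box. -/
def vectorField (A : JetCoord → D.points → ℝ) (f : D.points → ℝ) : D.points → ℝ :=
  fun j => ∑ᶠ c, A c j * pderiv c f j

theorem vectorField_eq_sum (A : JetCoord → D.points → ℝ) {s : Finset JetCoord}
    {f : D.points → ℝ} (h : SmoothIn D s f) :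
    vectorField A f = ∑ c ∈ s, A c * pderiv c f := by
  funext j
  rw [Finset.sum_apply]
  refine finsum_eq_sum_of_support_subset _ fun c hc => ?_
  by_contra hcs
  exact hc (by simp [h.pderiv_eq_zero hcs j])

theorem vectorField_mem {S T : Set JetCoord} (hST : S ⊆ T) {A : JetCoord → D.points → ℝ}
    (hA : ∀ c ∈ S, A c ∈ functionsOf D T) {f : D.points → ℝ} (hf : f ∈ functionsOf D S) :
    vectorField A f ∈ functionsOf D T := by
  obtain ⟨s, hs, h⟩ := hf
  rw [vectorField_eq_sum A h]
  exact sum_mem fun c hc => mul_mem_functionsOf (hA c (hs hc))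
    ((h.pderiv c).mem_functionsOf (hs.trans hST))

theorem vectorField_mem_differentialFunctions {A : JetCoord → D.points → ℝ}
    (hA : ∀ c, A c ∈ differentialFunctions D) {f : D.points → ℝ}
    (hf : f ∈ differentialFunctions D) : vectorField A f ∈ differentialFunctions D :=
  vectorField_mem subset_rfl (fun c _ => hA c) hf

theorem vectorField_add (A : JetCoord → D.points → ℝ) {f₁ f₂ : D.points → ℝ}
    (h₁ : f₁ ∈ differentialFunctions D) (h₂ : f₂ ∈ differentialFunctions D) :
    vectorField A (f₁ + f₂) = vectorField A f₁ + vectorField A f₂ := by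
  obtain ⟨s₁, -, hs₁⟩ := id h₁
  obtain ⟨s₂, -, hs₂⟩ := id h₂
  have k₁ := hs₁.mono (Finset.subset_union_left (s₂ := s₂))
  have k₂ := hs₂.mono (Finset.subset_union_right (s₁ := s₁))
  rw [vectorField_eq_sum A k₁, vectorField_eq_sum A k₂, vectorField_eq_sum A (k₁.add k₂),
    ← Finset.sum_add_distrib]
  exact Finset.sum_congr rfl fun c _ => by rw [pderiv_add' h₁ h₂, mul_add]

theorem vectorField_sub (A : JetCoord → D.points → ℝ) {f₁ f₂ : D.points → ℝ}
    (h₁ : f₁ ∈ differentialFunctions D) (h₂ : f₂ ∈ differentialFunctions D) :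
    vectorField A (f₁ - f₂) = vectorField A f₁ - vectorField A f₂ := by
  have h := vectorField_add A (sub_mem h₁ h₂) h₂
  rw [sub_add_cancel] at h
  exact eq_sub_of_add_eq h.symm

theorem vectorField_zero_right (A : JetCoord → D.points → ℝ) :
    vectorField A (0 : D.points → ℝ) = 0 := by
  rw [vectorField_eq_sum A (SmoothIn.zero ∅), Finset.sum_empty]

theorem vectorField_zero_left (f : D.points → ℝ) : vectorField (fun _ => 0) f = 0 := by
  funext j
  simp [vectorField]

theorem vectorField_single (e : JetCoord) (f : D.points → ℝ) :
    vectorField (fun c _ => if c = e then 1 else 0) f = pderiv e f := by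
  funext j
  rw [vectorField, finsum_eq_single _ e fun c hc => by simp [hc]]
  simp

theorem vectorField_coord (A : JetCoord → D.points → ℝ) (d : JetCoord) :
    vectorField A (fun j => j.1 d) = A d := by
  funext j
  rw [vectorField, finsum_eq_single _ d fun c hc => by simp [pderiv_coord, Ne.symm hc]]
  simp [pderiv_coord]

theorem vectorField_const (A : JetCoord → D.points → ℝ) (a : ℝ) :
    vectorField A (fun _ => a) = 0 := by
  funext j
  simp [vectorField, pderiv_const]

theorem pderiv_vectorField {A : JetCoord → D.points → ℝ}
    (hA : ∀ c, A c ∈ differentialFunctions D) {f : D.points → ℝ}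
    (hf : f ∈ differentialFunctions D) (d : JetCoord) :
    pderiv d (vectorField A f) =
      vectorField (fun c => pderiv d (A c)) f + vectorField A (pderiv d f) := by
  obtain ⟨s, -, h⟩ := id hf
  have hp := fun c => pderiv_mem_functionsOf hf c
  rw [vectorField_eq_sum A h, vectorField_eq_sum _ h, vectorField_eq_sum A (h.pderiv d),
    pderiv_sum s (fun c _ => mul_mem_functionsOf (hA c) (hp c)), ← Finset.sum_add_distrib]
  exact Finset.sum_congr rfl fun c _ => by rw [pderiv_mul (hA c) (hp c), pderiv_comm hf d c]

/-- The second-order part is split off because it is symmetric in the two fields; the commutator is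
then read off from the first sum. -/
theorem vectorField_vectorField (A : JetCoord → D.points → ℝ) {B : JetCoord → D.points → ℝ}
    (hB : ∀ c, B c ∈ differentialFunctions D) {s : Finset JetCoord} {f : D.points → ℝ}
    (h : SmoothIn D s f) :
    vectorField A (vectorField B f) = ∑ d ∈ s, vectorField A (B d) * pderiv d f +
      ∑ d ∈ s, ∑ c ∈ s, A c * B d * pderiv c (pderiv d f) := by
  have hf : f ∈ differentialFunctions D := h.mem_functionsOf (Set.subset_univ _)
  funext j
  have hfin : ∀ d ∈ s,
      (Function.support fun c => A c j * pderiv c (B d) j * pderiv d f j).Finite := by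
    intro d _
    obtain ⟨t, -, ht⟩ := hB d
    refine t.finite_toSet.subset fun c hc => ?_
    by_contra hct
    exact hc (by simp [ht.pderiv_eq_zero hct j])
  have e1 : ∀ c, A c j * pderiv c (vectorField B f) j =
      ∑ d ∈ s, A c j * pderiv c (B d) j * pderiv d f j + A c j * vectorField B (pderiv c f) j := by
    intro c
    rw [pderiv_vectorField hB hf, Pi.add_apply, mul_add, vectorField_eq_sum _ h]
    simp [Finset.mul_sum, mul_assoc]
  have hfin2 : (Function.support fun c => A c j * vectorField B (pderiv c f) j).Finite := by
    refine s.finite_toSet.subset fun c hc => ?_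
    by_contra hcs
    refine hc ?_
    simp only
    rw [show pderiv c f = 0 from funext (h.pderiv_eq_zero hcs), vectorField_zero_right]
    simp
  rw [vectorField]
  simp only [e1]
  rw [finsum_add_distrib _ hfin2, finsum_sum_comm _ _ hfin, Pi.add_apply, Finset.sum_apply,
    Finset.sum_apply]
  · congr 1
    · refine Finset.sum_congr rfl fun d hd => ?_
      rw [Pi.mul_apply, vectorField, finsum_mul]
    · rw [finsum_eq_sum_of_support_subset (s := s)]
      · simp only [vectorField_eq_sum B (h.pderiv _), Finset.sum_apply, Pi.mul_apply,
          Finset.mul_sum]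
        rw [Finset.sum_comm]
        refine Finset.sum_congr rfl fun d _ => Finset.sum_congr rfl fun c _ => ?_
        rw [pderiv_comm hf c d]
        ring
      · intro c hc
        by_contra hcs
        refine hc ?_
        simp only
        rw [show pderiv c f = 0 from funext (h.pderiv_eq_zero hcs), vectorField_zero_right]
        simp
  · refine (Set.Finite.biUnion s.finite_toSet hfin).subset fun c hc => ?_
    by_contra hcs
    refine hc (Finset.sum_eq_zero fun d hd => ?_)
    by_contra h0
    exact hcs (Set.mem_biUnion (Finset.mem_coe.2 hd) h0)

/-- Vector fields with `A (B c) = B (A c)` for all coordinates `c` commute. -/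
theorem vectorField_comm {A B : JetCoord → D.points → ℝ}
    (hA : ∀ c, A c ∈ differentialFunctions D) (hB : ∀ c, B c ∈ differentialFunctions D)
    (hAB : ∀ c, vectorField A (B c) = vectorField B (A c)) {f : D.points → ℝ}
    (hf : f ∈ differentialFunctions D) :
    vectorField A (vectorField B f) = vectorField B (vectorField A f) := by
  obtain ⟨s, -, h⟩ := id hf
  rw [vectorField_vectorField A hB h, vectorField_vectorField B hA h]
  congr 1
  · exact Finset.sum_congr rfl fun d _ => by rw [hAB]
  · rw [Finset.sum_comm]
    refine Finset.sum_congr rfl fun c _ => Finset.sum_congr rfl fun d _ => ?_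
    rw [pderiv_comm hf d c, mul_comm (A c)]

/-! ### Total derivatives and their restrictions to solutions -/

/-- The coefficients of the total derivative `D_ξ`. -/
def coeffXi : JetCoord → D.points → ℝ
  | .xi => fun _ => 1
  | .eta => fun _ => 0
  | .w k l => fun j => j.1 (.w (k + 1) l)

/-- The coefficients of the total derivative `D_η`. -/
def coeffEta : JetCoord → D.points → ℝ
  | .xi => fun _ => 0
  | .eta => fun _ => 1
  | .w k l => fun j => j.1 (.w k (l + 1))

/-- The coefficients of the total derivative `D_ξ` restricted to the solution manifold. -/
def solCoeffXi : JetCoord → D.points → ℝ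
  | .xi => fun _ => 1
  | .w k 0 => fun j => j.1 (.w (k + 1) 0)
  | _ => fun _ => 0

/-- The coefficients of the total derivative `D_η` restricted to the solution manifold. -/
def solCoeffEta : JetCoord → D.points → ℝ
  | .eta => fun _ => 1
  | .w 0 l => fun j => j.1 (.w 0 (l + 1))
  | _ => fun _ => 0

/-- Links the sums over index pairs in `totalXi` and `totalEta` with the sum over all coordinates in
`vectorField`. -/
theorem finsum_jetCoord {b : JetCoord → ℝ} {s : Finset JetCoord} (hb : ∀ c ∉ s, b c = 0) :
    ∑ᶠ c, b c = b .xi + b .eta + ∑ᶠ p : ℕ × ℕ, b (.w p.1 p.2) := by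
  have hinj : Function.Injective fun p : ℕ × ℕ => JetCoord.w p.1 p.2 := by
    rintro ⟨a, b⟩ ⟨c, d⟩ h
    simpa using h
  set P := s.preimage (fun p : ℕ × ℕ => JetCoord.w p.1 p.2) hinj.injOn with hP
  rw [finsum_eq_sum_of_support_subset (s := insert .xi (insert .eta (P.image fun p =>
      JetCoord.w p.1 p.2))), finsum_eq_sum_of_support_subset (s := P),
    Finset.sum_insert (by simp), Finset.sum_insert (by simp), Finset.sum_image hinj.injOn,
    add_assoc]
  · intro p hp
    by_contra h
    exact hp (hb _ (by simpa [hP] using h))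
  · intro c hc
    have hcs : c ∈ s := by
      by_contra h
      exact hc (hb c h)
    cases c with
    | xi => simp
    | eta => simp
    | w k l => simpa [hP] using hcs

theorem totalXi_eq_vectorField {f : D.points → ℝ} (hf : f ∈ differentialFunctions D) :
    totalXi f = vectorField coeffXi f := by
  obtain ⟨s, -, h⟩ := hf
  funext j
  rw [vectorField, finsum_jetCoord (s := s) fun c hc => by simp [h.pderiv_eq_zero hc j]]
  simp [totalXi, coeffXi]

theorem totalEta_eq_vectorField {f : D.points → ℝ} (hf : f ∈ differentialFunctions D) :
    totalEta f = vectorField coeffEta f := by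
  obtain ⟨s, -, h⟩ := hf
  funext j
  rw [vectorField, finsum_jetCoord (s := s) fun c hc => by simp [h.pderiv_eq_zero hc j]]
  simp [totalEta, coeffEta]

theorem coeffXi_mem (c : JetCoord) : (coeffXi c : D.points → ℝ) ∈ differentialFunctions D := by
  cases c with
  | xi => exact const_mem_functionsOf _ 1
  | eta => exact const_mem_functionsOf _ 0
  | w k l => exact coord_mem_functionsOf (Set.mem_univ _)

theorem coeffEta_mem (c : JetCoord) : (coeffEta c : D.points → ℝ) ∈ differentialFunctions D := by
  cases c with
  | xi => exact const_mem_functionsOf _ 0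
  | eta => exact const_mem_functionsOf _ 1
  | w k l => exact coord_mem_functionsOf (Set.mem_univ _)

theorem totalXi_totalEta_comm {f : D.points → ℝ} (hf : f ∈ differentialFunctions D) :
    totalXi (totalEta f) = totalEta (totalXi f) := by
  have h1 := vectorField_mem_differentialFunctions coeffXi_mem hf
  have h2 := vectorField_mem_differentialFunctions coeffEta_mem hf
  rw [totalXi_eq_vectorField hf, totalEta_eq_vectorField hf, totalXi_eq_vectorField h2,
    totalEta_eq_vectorField h1]
  refine vectorField_comm coeffXi_mem coeffEta_mem (fun c => ?_) hf
  cases c with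
  | xi => exact (vectorField_const _ 0).trans (vectorField_const _ 1).symm
  | eta => exact (vectorField_const _ 1).trans (vectorField_const _ 0).symm
  | w k l =>
    exact (vectorField_coord coeffXi (.w k (l + 1))).trans
      (vectorField_coord coeffEta (.w (k + 1) l)).symm

theorem coeffXi_eq_of_mem {j : D.points} (hj : j ∈ solutionManifold D) (c : JetCoord) :
    coeffXi c j = solCoeffXi c j := by
  rcases c with _ | _ | ⟨k, _ | l⟩
  · rfl
  · rfl
  · rfl
  · exact hj k l

theorem coeffEta_eq_of_mem {j : D.points} (hj : j ∈ solutionManifold D) (c : JetCoord) :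
    coeffEta c j = solCoeffEta c j := by
  rcases c with _ | _ | ⟨_ | k, l⟩
  · rfl
  · rfl
  · rfl
  · exact hj k l

theorem totalXi_eq_of_mem {f : D.points → ℝ} (hf : f ∈ differentialFunctions D)
    {j : D.points} (hj : j ∈ solutionManifold D) : totalXi f j = vectorField solCoeffXi f j := by
  rw [totalXi_eq_vectorField hf]
  exact finsum_congr fun c => by rw [coeffXi_eq_of_mem hj]

theorem totalEta_eq_of_mem {f : D.points → ℝ} (hf : f ∈ differentialFunctions D)
    {j : D.points} (hj : j ∈ solutionManifold D) :
    totalEta f j = vectorField solCoeffEta f j := by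
  rw [totalEta_eq_vectorField hf]
  exact finsum_congr fun c => by rw [coeffEta_eq_of_mem hj]

/-! ### Functions of the unmixed coordinates, filtered by order in ξ -/

/-- The jet coordinates other than the mixed derivatives. -/
def pureCoords : Set JetCoord := {c | ∀ k l, c = .w k l → k = 0 ∨ l = 0}

/-- The jet coordinates other than the mixed derivatives and the `w_{k0}` with `k > m`. -/
def pureCoordsLE (m : ℕ) : Set JetCoord := {c | ∀ k l, c = .w k l → (k = 0 ∨ l = 0) ∧ k ≤ m}

theorem mem_pureCoords_w {k l : ℕ} : JetCoord.w k l ∈ pureCoords ↔ k = 0 ∨ l = 0 := by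
  simp [pureCoords]

theorem mem_pureCoordsLE_w {m k l : ℕ} :
    JetCoord.w k l ∈ pureCoordsLE m ↔ (k = 0 ∨ l = 0) ∧ k ≤ m := by
  simp [pureCoordsLE]

theorem xi_mem_pureCoordsLE (m : ℕ) : JetCoord.xi ∈ pureCoordsLE m := by simp [pureCoordsLE]

theorem pureCoordsLE_mono {m n : ℕ} (h : m ≤ n) : pureCoordsLE m ⊆ pureCoordsLE n :=
  fun _ hc k l hkl => ⟨(hc k l hkl).1, (hc k l hkl).2.trans h⟩

theorem pureCoordsLE_subset (m : ℕ) : pureCoordsLE m ⊆ pureCoords :=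
  fun _ hc k l hkl => (hc k l hkl).1

theorem pureCoordsLE_succ_diff (m : ℕ) :
    pureCoordsLE (m + 1) \ {JetCoord.w (m + 1) 0} ⊆ pureCoordsLE m := by
  rintro c ⟨hc, hcm⟩ k l rfl
  obtain ⟨h1, h2⟩ := hc k l rfl
  refine ⟨h1, ?_⟩
  rcases h1 with rfl | rfl
  · exact Nat.zero_le m
  · simp only [Set.mem_singleton_iff, JetCoord.w.injEq, and_true] at hcm
    omega

theorem exists_mem_pureCoordsLE {f : D.points → ℝ} (hf : f ∈ functionsOf D pureCoords) :
    ∃ m, f ∈ functionsOf D (pureCoordsLE m) := by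
  obtain ⟨s, hs, h⟩ := hf
  refine ⟨s.sup fun c => match c with | .w k _ => k | _ => 0, s, fun c hc k l hkl =>
    ⟨hs hc k l hkl, ?_⟩, h⟩
  subst hkl
  exact Finset.le_sup (f := fun c => match c with | .w k _ => k | _ => 0) hc

theorem solCoeffXi_mem_pureCoordsLE {m : ℕ} {c : JetCoord} (hc : c ∈ pureCoordsLE m) :
    (solCoeffXi c : D.points → ℝ) ∈ functionsOf D (pureCoordsLE (m + 1)) := by
  rcases c with _ | _ | ⟨k, _ | l⟩
  · exact const_mem_functionsOf _ 1
  · exact const_mem_functionsOf _ 0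
  · refine coord_mem_functionsOf ?_
    rw [mem_pureCoordsLE_w] at hc ⊢
    omega
  · exact const_mem_functionsOf _ 0

theorem solCoeffEta_mem_pureCoordsLE {m : ℕ} (c : JetCoord) :
    (solCoeffEta c : D.points → ℝ) ∈ functionsOf D (pureCoordsLE m) := by
  rcases c with _ | _ | ⟨_ | k, l⟩
  · exact const_mem_functionsOf _ 0
  · exact const_mem_functionsOf _ 1
  · refine coord_mem_functionsOf ?_
    simp [mem_pureCoordsLE_w]
  · exact const_mem_functionsOf _ 0

theorem solCoeffXi_mem (c : JetCoord) :
    (solCoeffXi c : D.points → ℝ) ∈ differentialFunctions D := by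
  rcases c with _ | _ | ⟨k, _ | l⟩
  · exact const_mem_functionsOf _ 1
  · exact const_mem_functionsOf _ 0
  · exact coord_mem_functionsOf (Set.mem_univ _)
  · exact const_mem_functionsOf _ 0

theorem solCoeffEta_mem (c : JetCoord) :
    (solCoeffEta c : D.points → ℝ) ∈ differentialFunctions D :=
  functionsOf_le (solCoeffEta_mem_pureCoordsLE (m := 0) c)

theorem solXi_mem_pureCoordsLE {m : ℕ} {f : D.points → ℝ}
    (hf : f ∈ functionsOf D (pureCoordsLE m)) :
    vectorField solCoeffXi f ∈ functionsOf D (pureCoordsLE (m + 1)) :=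
  vectorField_mem (pureCoordsLE_mono m.le_succ) (fun _ hc => solCoeffXi_mem_pureCoordsLE hc) hf

theorem solEta_mem_pureCoordsLE {m : ℕ} {f : D.points → ℝ}
    (hf : f ∈ functionsOf D (pureCoordsLE m)) :
    vectorField solCoeffEta f ∈ functionsOf D (pureCoordsLE m) :=
  vectorField_mem subset_rfl (fun c _ => solCoeffEta_mem_pureCoordsLE c) hf

theorem solXi_mem {f : D.points → ℝ} (hf : f ∈ differentialFunctions D) :
    vectorField solCoeffXi f ∈ differentialFunctions D :=
  vectorField_mem_differentialFunctions solCoeffXi_mem hf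

theorem solEta_mem {f : D.points → ℝ} (hf : f ∈ differentialFunctions D) :
    vectorField solCoeffEta f ∈ differentialFunctions D :=
  vectorField_mem_differentialFunctions solCoeffEta_mem hf

/-- Each field annihilates the coefficients of the other: D̂_ξ kills constants and w_{0l}, l ≥ 1,
while D̂_η kills constants and w_{k0}, k ≥ 1. -/
theorem solXi_solEta_comm {f : D.points → ℝ} (hf : f ∈ differentialFunctions D) :
    vectorField solCoeffXi (vectorField solCoeffEta f) =
      vectorField solCoeffEta (vectorField solCoeffXi f) := by
  refine vectorField_comm solCoeffXi_mem solCoeffEta_mem (fun c => ?_) hf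
  rcases c with _ | _ | ⟨_ | k, _ | l⟩
  · exact (vectorField_const _ 0).trans (vectorField_const _ 1).symm
  · exact (vectorField_const _ 1).trans (vectorField_const _ 0).symm
  · exact (vectorField_coord solCoeffXi (.w 0 1)).trans
      (vectorField_coord solCoeffEta (.w 1 0)).symm
  · exact (vectorField_coord solCoeffXi (.w 0 (l + 1 + 1))).trans (vectorField_const _ 0).symm
  · exact (vectorField_const _ 0).trans (vectorField_coord solCoeffEta (.w (k + 1 + 1) 0)).symm
  · exact (vectorField_const _ 0).trans (vectorField_const _ 0).symm

/-! ### Commutators with partial derivatives and the kernel of D̂_η -/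

theorem pderiv_solXi_succ {f : D.points → ℝ} (hf : f ∈ differentialFunctions D) (k : ℕ) :
    pderiv (.w (k + 1) 0) (vectorField solCoeffXi f) =
      pderiv (.w k 0) f + vectorField solCoeffXi (pderiv (.w (k + 1) 0) f) := by
  -- w_{k+1,0} occurs in D̂_ξ only as the coefficient of ∂_{w_{k0}}, so the commutator is
  -- ∂_{w_{k0}}.
  rw [pderiv_vectorField solCoeffXi_mem hf, ← vectorField_single (.w k 0) f]
  congr 2
  funext c
  rcases c with _ | _ | ⟨i, _ | l⟩
  · simp [solCoeffXi, pderiv_const, Pi.zero_def]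
  · simp [solCoeffXi, pderiv_const, Pi.zero_def]
  · simp [solCoeffXi, pderiv_coord]
  · simp [solCoeffXi, pderiv_const, Pi.zero_def]

theorem pderiv_solXi_zero {f : D.points → ℝ} (hf : f ∈ differentialFunctions D) :
    pderiv (.w 0 0) (vectorField solCoeffXi f) =
      vectorField solCoeffXi (pderiv (.w 0 0) f) := by
  rw [pderiv_vectorField solCoeffXi_mem hf]
  suffices h : (fun c => pderiv (.w 0 0) (solCoeffXi c : D.points → ℝ)) = fun _ => 0 by
    rw [h, vectorField_zero_left, zero_add]
  funext c
  rcases c with _ | _ | ⟨i, _ | l⟩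
  · exact pderiv_const _ _
  · exact pderiv_const _ _
  · exact (pderiv_coord _ _).trans (by simp [Pi.zero_def])
  · exact pderiv_const _ _

theorem pderiv_solEta_succ {f : D.points → ℝ} (hf : f ∈ differentialFunctions D) (l : ℕ) :
    pderiv (.w 0 (l + 1)) (vectorField solCoeffEta f) =
      pderiv (.w 0 l) f + vectorField solCoeffEta (pderiv (.w 0 (l + 1)) f) := by
  rw [pderiv_vectorField solCoeffEta_mem hf, ← vectorField_single (.w 0 l) f]
  congr 2
  funext c
  rcases c with _ | _ | ⟨_ | k, i⟩
  · simp [solCoeffEta, pderiv_const, Pi.zero_def]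
  · simp [solCoeffEta, pderiv_const, Pi.zero_def]
  · simp [solCoeffEta, pderiv_coord]
  · simp [solCoeffEta, pderiv_const, Pi.zero_def]

theorem pderiv_solEta {f : D.points → ℝ} (hf : f ∈ differentialFunctions D) {d : JetCoord}
    (hd : ∀ l, d ≠ .w 0 (l + 1)) :
    pderiv d (vectorField solCoeffEta f) = vectorField solCoeffEta (pderiv d f) := by
  rw [pderiv_vectorField solCoeffEta_mem hf]
  suffices h : (fun c => pderiv d (solCoeffEta c : D.points → ℝ)) = fun _ => 0 by
    rw [h, vectorField_zero_left, zero_add]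
  funext c
  rcases c with _ | _ | ⟨_ | k, i⟩
  · exact pderiv_const _ _
  · exact pderiv_const _ _
  · exact (pderiv_coord _ _).trans (by simp [(hd i).symm, Pi.zero_def])
  · exact pderiv_const _ _

theorem solEta_eq_zero {A : Set JetCoord} {f : D.points → ℝ} (hf : f ∈ functionsOf D A)
    (hA : JetCoord.eta ∉ A) (hA' : ∀ l, JetCoord.w 0 l ∉ A) :
    vectorField solCoeffEta f = 0 := by
  funext j
  refine finsum_eq_zero_of_forall_eq_zero fun c => ?_
  rcases c with _ | _ | ⟨_ | k, l⟩
  · exact zero_mul _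
  · simp [pderiv_eq_zero_of_notMem hf hA]
  · simp [pderiv_eq_zero_of_notMem hf (hA' l)]
  · exact zero_mul _

theorem solXi_eq_zero {A : Set JetCoord} {f : D.points → ℝ} (hf : f ∈ functionsOf D A)
    (hA : JetCoord.xi ∉ A) (hA' : ∀ k, JetCoord.w k 0 ∉ A) :
    vectorField solCoeffXi f = 0 := by
  funext j
  refine finsum_eq_zero_of_forall_eq_zero fun c => ?_
  rcases c with _ | _ | ⟨k, _ | l⟩
  · simp [pderiv_eq_zero_of_notMem hf hA]
  · exact zero_mul _
  · simp [pderiv_eq_zero_of_notMem hf (hA' k)]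
  · exact zero_mul _

theorem exists_pderiv_w_eq_zero {f : D.points → ℝ} (hf : f ∈ differentialFunctions D) :
    ∃ L, ∀ l, L ≤ l → pderiv (.w 0 l) f = 0 := by
  obtain ⟨s, -, h⟩ := hf
  refine ⟨s.sup (fun c => match c with | .w _ l => l | _ => 0) + 1, fun l hl =>
    funext (h.pderiv_eq_zero fun hc => ?_)⟩
  have := Finset.le_sup (f := fun c => match c with | JetCoord.w _ l => l | _ => 0) hc
  simp only at this
  omega

/-- The coordinates `η` and `w_{0l}`. -/
def etaCoords : Set JetCoord := {JetCoord.eta} ∪ Set.range (JetCoord.w 0)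

/-- The kernel of the restricted total derivative `D_η`: functions without `η` and `w_{0l}`. -/
theorem mem_functionsOf_of_solEta_eq_zero {A : Set JetCoord} {f : D.points → ℝ}
    (hf : f ∈ functionsOf D A) (h : vectorField solCoeffEta f = 0) :
    f ∈ functionsOf D (A \ etaCoords) := by
  have hd := functionsOf_le hf
  -- The commutator of ∂_{w_{0,l+1}} with D̂_η is ∂_{w_{0l}}, so independence of the high
  -- derivatives, true for large l, descends to all l.
  have down : ∀ l, pderiv (.w 0 (l + 1)) f = 0 → pderiv (.w 0 l) f = 0 := by
    intro l hl
    have := pderiv_solEta_succ hd l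
    rwa [h, pderiv_zero, hl, vectorField_zero_right, add_zero, eq_comm] at this
  obtain ⟨L, hL⟩ := exists_pderiv_w_eq_zero hd
  have hw : ∀ l, pderiv (.w 0 l) f = 0 := by
    intro l
    rcases le_total L l with hl | hl
    · exact hL l hl
    · exact Nat.decreasingInduction (motive := fun l _ => pderiv (.w 0 l) f = 0)
        (fun k _ hk => down k hk) (hL L le_rfl) hl
  have heta : pderiv .eta f = 0 := by
    rw [← h]
    funext j
    rw [vectorField, finsum_eq_single _ .eta]
    · exact (one_mul _).symm
    · rintro (_ | _ | ⟨_ | k, l⟩) hc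
      · exact zero_mul _
      · exact absurd rfl hc
      · simp [hw l]
      · exact zero_mul _
  refine mem_functionsOf_diff hf ?_
  rintro c (rfl | ⟨l, rfl⟩)
  · exact heta
  · exact hw l

/-! ### Construction of the potential -/

theorem pderiv_eq_zero_of_divergence {m : ℕ} {F G : D.points → ℝ}
    (hF : F ∈ functionsOf D (pureCoordsLE m)) (hG : G ∈ functionsOf D (pureCoordsLE m))
    (h : vectorField solCoeffXi F + vectorField solCoeffEta G = 0) :
    pderiv (.w m 0) F = 0 := by
  have hm : JetCoord.w (m + 1) 0 ∉ pureCoordsLE m := by simp [mem_pureCoordsLE_w]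
  have hF' := functionsOf_le hF
  have hG' := functionsOf_le hG
  -- Neither F nor G involves w_{m+1,0}; it enters the equation only as the factor of ∂_{w_{m0}} F
  -- in D̂_ξ F.
  have h1 := congrArg (pderiv (.w (m + 1) 0)) h
  rw [pderiv_add' (solXi_mem hF') (solEta_mem hG'), pderiv_solXi_succ hF',
    pderiv_solEta hG' (by simp), pderiv_eq_zero_of_notMem hF hm, pderiv_eq_zero_of_notMem hG hm,
    vectorField_zero_right, vectorField_zero_right, pderiv_zero] at h1
  simpa using h1

theorem solXi_eq_of_mem_zero {f : D.points → ℝ} (hf : f ∈ functionsOf D (pureCoordsLE 0)) :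
    vectorField solCoeffXi f =
      pderiv .xi f + (fun j => j.1 (.w 1 0)) * pderiv (.w 0 0) f := by
  funext j
  rw [vectorField, finsum_eq_sum_of_support_subset (s := {.xi, .w 0 0}),
    Finset.sum_pair (by simp)]
  · simp [solCoeffXi]
  · rintro (_ | _ | ⟨_ | k, _ | l⟩) hc
    · simp
    · exact absurd (zero_mul _) hc
    · simp
    · exact absurd (zero_mul _) hc
    · refine absurd ?_ hc
      simp [pderiv_eq_zero_of_notMem hf
        (show JetCoord.w (k + 1) 0 ∉ pureCoordsLE 0 by simp [mem_pureCoordsLE_w])]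
    · exact absurd (zero_mul _) hc

theorem solDivergence_add_sub {F G H : D.points → ℝ} (hF : F ∈ differentialFunctions D)
    (hG : G ∈ differentialFunctions D) (hH : H ∈ differentialFunctions D)
    (h : vectorField solCoeffXi F + vectorField solCoeffEta G = 0) :
    vectorField solCoeffXi (F + vectorField solCoeffEta H) +
      vectorField solCoeffEta (G - vectorField solCoeffXi H) = 0 := by
  rw [vectorField_add _ hF (solEta_mem hH), vectorField_sub _ hG (solXi_mem hH),
    solXi_solEta_comm hH, ← h]
  abel

/-- The coordinates `η` and `w_{0l}`, `l ≥ 1`. -/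
abbrev leftCoords : Set JetCoord := {JetCoord.eta} ∪ {c | ∃ l : ℕ, 1 ≤ l ∧ c = JetCoord.w 0 l}

/-- The coordinates `ξ` and `w_{k0}`, `k ≥ 1`. -/
abbrev rightCoords : Set JetCoord := {JetCoord.xi} ∪ {c | ∃ k : ℕ, 1 ≤ k ∧ c = JetCoord.w k 0}

theorem pureCoordsLE_diff_etaCoords (m : ℕ) :
    pureCoordsLE m \ etaCoords ⊆ pureCoordsLE m ∩ rightCoords := by
  rintro c ⟨hc, hc'⟩
  refine ⟨hc, ?_⟩
  rcases c with _ | _ | ⟨_ | k, l⟩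
  · simp
  · simp [etaCoords] at hc'
  · simp [etaCoords] at hc'
  · rw [mem_pureCoordsLE_w] at hc
    obtain rfl : l = 0 := by omega
    exact Or.inr ⟨k + 1, by simp, rfl⟩

theorem eta_notMem_rightCoords : JetCoord.eta ∉ rightCoords := by simp

theorem w_notMem_rightCoords (l : ℕ) : JetCoord.w 0 l ∉ rightCoords := by
  rintro (h | ⟨k, hk, h⟩)
  · simp at h
  · simp at h
    omega

/-- Since ∂_w F = 0, the equation reads ∂_ξ F + D̂_η G = 0. With H the ξ-primitive of G, the first
component loses ξ and the second becomes -w_{10} ∂_w H. Both have the required form once ∂_w H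
depends on ξ alone, which follows from D̂_η ∂_w G = 0. -/
theorem exists_potential_zero {F G : D.points → ℝ}
    (hF : F ∈ functionsOf D (pureCoordsLE 0)) (hG : G ∈ functionsOf D (pureCoordsLE 0))
    (h : vectorField solCoeffXi F + vectorField solCoeffEta G = 0) :
    ∃ H ∈ functionsOf D pureCoords, F + vectorField solCoeffEta H ∈ functionsOf D leftCoords ∧
      G - vectorField solCoeffXi H ∈ functionsOf D rightCoords := by
  have hF' := functionsOf_le hF
  have hG' := functionsOf_le hG
  have hFw : pderiv (.w 0 0) F = 0 := pderiv_eq_zero_of_divergence hF hG h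
  have hGw : pderiv (.w 0 0) G ∈ functionsOf D (pureCoordsLE 0 \ etaCoords) := by
    refine mem_functionsOf_of_solEta_eq_zero (pderiv_mem_functionsOf hG _) ?_
    have h1 := congrArg (pderiv (.w 0 0)) h
    rwa [pderiv_add' (solXi_mem hF') (solEta_mem hG'), pderiv_solXi_zero hF',
      pderiv_solEta hG' (by simp), hFw, vectorField_zero_right, pderiv_zero, zero_add] at h1
  set H := primitive .xi G with hHdef
  have hH : H ∈ functionsOf D (pureCoordsLE 0) :=
    primitive_mem_functionsOf hG (xi_mem_pureCoordsLE 0)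
  have hH' := functionsOf_le hH
  have hHxi : pderiv .xi H = G := pderiv_primitive hG' .xi
  set K := pderiv (.w 0 0) H with hKdef
  have hK : K ∈ functionsOf D (pureCoordsLE 0) := pderiv_mem_functionsOf hH _
  have hK' := functionsOf_le hK
  have hKd : K ∈ functionsOf D (pureCoordsLE 0 \ etaCoords) := by
    refine mem_functionsOf_diff hK fun d hd => ?_
    have hdx : JetCoord.xi ≠ d := by
      rintro rfl
      simp [etaCoords] at hd
    -- ∂_ξ ∂_d K = ∂_d ∂_w G = 0, and ∂_d K vanishes where ξ has its base value because the chosen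
    -- primitive H does.
    refine eq_zero_of_pderiv_eq_zero (c := .xi) (pderiv_mem_functionsOf hK' d) ?_ ?_
    · rw [pderiv_comm hK', hKdef, pderiv_comm hH', hHxi]
      exact pderiv_eq_zero_of_notMem hGw fun hmem => hmem.2 hd
    · exact fun j hj => pderiv_eq_zero_of_vanishing hdx (fun j hj =>
        pderiv_eq_zero_of_vanishing (by simp) (fun j hj => primitive_eq_zero G hj) hj) hj
  have hKr : K ∈ functionsOf D rightCoords :=
    functionsOf_mono ((pureCoordsLE_diff_etaCoords 0).trans Set.inter_subset_right) hKd
  refine ⟨H, functionsOf_mono (pureCoordsLE_subset 0) hH, ?_, ?_⟩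
  · have hsum := add_mem hF (solEta_mem_pureCoordsLE hH)
    have h1 : pderiv .xi (F + vectorField solCoeffEta H) = 0 := by
      rw [pderiv_add' hF' (solEta_mem hH'), pderiv_solEta hH' (by simp), hHxi, ← h,
        solXi_eq_of_mem_zero hF, hFw, mul_zero, add_zero]
    have h2 : pderiv (.w 0 0) (F + vectorField solCoeffEta H) = 0 := by
      rw [pderiv_add' hF' (solEta_mem hH'), pderiv_solEta hH' (by simp), hFw, zero_add]
      exact solEta_eq_zero hKr eta_notMem_rightCoords w_notMem_rightCoords
    have h3 := mem_functionsOf_diff (B := {.xi, .w 0 0}) hsum (by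
      rintro c (rfl | rfl)
      · exact h1
      · exact h2)
    refine functionsOf_mono ?_ h3
    rintro (_ | _ | ⟨k, l⟩) ⟨hc, hc'⟩
    · simp at hc'
    · simp
    · rw [mem_pureCoordsLE_w] at hc
      obtain rfl : k = 0 := by omega
      refine Or.inr ⟨l, ?_, rfl⟩
      by_contra hl
      obtain rfl : l = 0 := by omega
      simp at hc'
  · rw [solXi_eq_of_mem_zero hH, hHxi, sub_add_cancel_left]
    exact neg_mem (mul_mem_functionsOf (coord_mem_functionsOf (Or.inr ⟨1, le_rfl, rfl⟩)) hKr)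

/-- Every current that is divergence-free for the restricted total derivatives differs from a
pair in `V` by the restricted curl of a potential. -/
theorem exists_potential (m : ℕ) {F G : D.points → ℝ}
    (hF : F ∈ functionsOf D (pureCoordsLE m)) (hG : G ∈ functionsOf D (pureCoordsLE m))
    (h : vectorField solCoeffXi F + vectorField solCoeffEta G = 0) :
    ∃ H ∈ functionsOf D pureCoords, F + vectorField solCoeffEta H ∈ functionsOf D leftCoords ∧
      G - vectorField solCoeffXi H ∈ functionsOf D rightCoords := by
  induction m generalizing F G with
  | zero => exact exists_potential_zero hF hG h
  | succ m ih =>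
    set a : JetCoord := .w (m + 1) 0 with ha
    have hF' := functionsOf_le hF
    have hG' := functionsOf_le hG
    have hFa : pderiv a F = 0 := pderiv_eq_zero_of_divergence hF hG h
    have hFm := functionsOf_mono (pureCoordsLE_succ_diff m)
      (mem_functionsOf_diff_singleton hF hFa)
    -- One ∂_a turns the equation into ∂_{w_{m0}} F + D̂_η ∂_a G = 0; a second one removes F, which
    -- is free of a.
    have hGaa : pderiv a (pderiv a G) ∈ functionsOf D (pureCoordsLE (m + 1) \ etaCoords) := by
      refine mem_functionsOf_of_solEta_eq_zero
        (pderiv_mem_functionsOf (pderiv_mem_functionsOf hG _) _) ?_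
      have hG1 := pderiv_mem_functionsOf hG' a
      have h1 := congrArg (pderiv a) (congrArg (pderiv a) h)
      have hm : a ∉ pureCoordsLE m := by simp [ha, mem_pureCoordsLE_w]
      rwa [pderiv_add' (solXi_mem hF') (solEta_mem hG'), pderiv_solXi_succ hF', hFa,
        vectorField_zero_right, add_zero, pderiv_solEta hG' (by simp [ha]),
        pderiv_add' (pderiv_mem_functionsOf hF' _) (solEta_mem hG1),
        pderiv_eq_zero_of_notMem (pderiv_mem_functionsOf hFm _) hm,
        pderiv_solEta hG1 (by simp [ha]), zero_add, pderiv_zero, pderiv_zero] at h1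
    have har : a ∈ pureCoordsLE (m + 1) ∩ rightCoords :=
      ⟨by simp [ha, mem_pureCoordsLE_w], Or.inr ⟨m + 1, by simp, rfl⟩⟩
    -- The twofold a-primitive involves only ξ and w_{k0}, k ≥ 1, so D̂_η Gr = 0 and subtracting Gr
    -- preserves the equation.
    obtain ⟨Gr, hGr, hGraa⟩ : ∃ Gr ∈ functionsOf D (pureCoordsLE (m + 1) ∩ rightCoords),
        pderiv a (pderiv a Gr) = pderiv a (pderiv a G) := by
      have hGaa' := functionsOf_mono (pureCoordsLE_diff_etaCoords (m + 1)) hGaa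
      have hGr1 := primitive_mem_functionsOf hGaa' har
      refine ⟨_, primitive_mem_functionsOf hGr1 har, ?_⟩
      rw [pderiv_primitive (functionsOf_le hGr1), pderiv_primitive (functionsOf_le hGaa')]
    have hGrm := functionsOf_mono Set.inter_subset_left hGr
    have hGrr := functionsOf_mono Set.inter_subset_right hGr
    have hGr' := functionsOf_le hGr
    have hGs := sub_mem hG hGrm
    have hGs' := functionsOf_le hGs
    have hE : vectorField solCoeffXi F + vectorField solCoeffEta (G - Gr) = 0 := by
      rw [vectorField_sub _ hG' hGr',
        solEta_eq_zero hGrr eta_notMem_rightCoords w_notMem_rightCoords, sub_zero, h]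
    have hg : pderiv a (G - Gr) ∈ functionsOf D (pureCoordsLE m) := by
      refine functionsOf_mono (pureCoordsLE_succ_diff m)
        (mem_functionsOf_diff_singleton (pderiv_mem_functionsOf hGs a) ?_)
      rw [pderiv_sub hG' hGr', pderiv_sub (pderiv_mem_functionsOf hG' _)
        (pderiv_mem_functionsOf hGr' _), hGraa, sub_self]
    -- G - Gr is affine in a with a slope free of a. As H is free of a too, ∂_a D̂_ξ H = ∂_{w_{m0}}
    -- H equals this slope, and D̂_ξ H cancels the term linear in a.
    obtain ⟨H, hH, hHd⟩ : ∃ H ∈ functionsOf D (pureCoordsLE m),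
        pderiv (.w m 0) H = pderiv a (G - Gr) :=
      ⟨_, primitive_mem_functionsOf hg (by simp [mem_pureCoordsLE_w]),
        pderiv_primitive (functionsOf_le hg) _⟩
    have hH' := functionsOf_le hH
    have hGm : G - Gr - vectorField solCoeffXi H ∈ functionsOf D (pureCoordsLE m) := by
      refine functionsOf_mono (pureCoordsLE_succ_diff m)
        (mem_functionsOf_diff_singleton (sub_mem hGs (solXi_mem_pureCoordsLE hH)) ?_)
      rw [pderiv_sub hGs' (solXi_mem hH'), pderiv_solXi_succ hH', hHd,
        pderiv_eq_zero_of_notMem hH (by simp [mem_pureCoordsLE_w]), vectorField_zero_right]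
      simp [ha]
    obtain ⟨H₂, hH₂, h1, h2⟩ := ih (add_mem hFm (solEta_mem_pureCoordsLE hH)) hGm
      (solDivergence_add_sub hF' hGs' hH' hE)
    have hH₂' := functionsOf_le hH₂
    refine ⟨H + H₂, add_mem (functionsOf_mono (pureCoordsLE_subset m) hH) hH₂, ?_, ?_⟩
    · rwa [vectorField_add _ hH' hH₂', ← add_assoc]
    · convert add_mem h2 hGrr using 1
      rw [vectorField_add _ hH' hH₂']
      abel

/-! ### Reduction to unmixed coordinates and trivial currents -/

theorem freeze_mem_solutionManifold (j : D.points) :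
    freeze pureCoordsᶜ j ∈ solutionManifold D := fun k l => by
  rw [freeze_of_mem (by simp [mem_pureCoords_w])]
  rfl

theorem freeze_eq_self {j : D.points} (hj : j ∈ solutionManifold D) :
    freeze pureCoordsᶜ j = j := by
  ext c
  by_cases hc : c ∈ pureCoords
  · exact freeze_of_notMem (by simpa using hc) j
  · rw [freeze_of_mem hc]
    rcases c with _ | _ | ⟨_ | k, _ | l⟩
    · simp [pureCoords] at hc
    · simp [pureCoords] at hc
    · simp [mem_pureCoords_w] at hc
    · simp [mem_pureCoords_w] at hc
    · simp [mem_pureCoords_w] at hc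
    · exact (hj k l).symm

theorem comp_freeze_mem_pureCoords {f : D.points → ℝ} (hf : f ∈ differentialFunctions D) :
    (fun j => f (freeze pureCoordsᶜ j)) ∈ functionsOf D pureCoords :=
  functionsOf_mono (by simp) (comp_freeze_mem_functionsOf pureCoordsᶜ hf)

theorem eq_zero_of_vanishing {f : D.points → ℝ} (hf : f ∈ functionsOf D pureCoords)
    (h : ∀ j ∈ solutionManifold D, f j = 0) : f = 0 := by
  funext j
  refine Eq.trans ?_ (h _ (freeze_mem_solutionManifold j))
  exact eq_of_eqOn hf fun c hc => (freeze_of_notMem (by simpa using hc) j).symm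

/-- Unmixed directions are tangent to the solution manifold, so the partial derivatives of `f`
vanish there; in the mixed directions the coefficients vanish. -/
theorem vectorField_eq_zero_of_vanishing {A : JetCoord → D.points → ℝ} {f : D.points → ℝ}
    (hf : ∀ j ∈ solutionManifold D, f j = 0) {j : D.points} (hj : j ∈ solutionManifold D)
    (hA : ∀ k l, A (.w (k + 1) (l + 1)) j = 0) : vectorField A f j = 0 := by
  refine finsum_eq_zero_of_forall_eq_zero fun c => ?_
  by_cases hc : ∃ k l, c = .w (k + 1) (l + 1)
  · obtain ⟨k, l, rfl⟩ := hc
    rw [hA, zero_mul]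
  · have : (fun t : ℝ => Function.extend Subtype.val f 0 (Function.update j.1 c t))
        =ᶠ[nhds (j.1 c)] fun _ => 0 := by
      filter_upwards [eventually_mem j c] with t ht
      rw [extend_apply f ht]
      refine hf _ fun k l => ?_
      rw [← hj k l]
      exact Function.update_of_ne (fun h => hc ⟨k, l, h.symm⟩) _ _
    rw [pderiv, this.deriv_eq, deriv_const, mul_zero]

theorem vanishingCurrents_le (D : JetBox) : vanishingCurrents D ≤ conservedCurrents D := by
  rintro P ⟨hP, h⟩
  refine ⟨hP, fun j hj => ?_⟩
  rw [divergence, totalXi_eq_of_mem hP.1 hj, totalEta_eq_of_mem hP.2 hj,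
    vectorField_eq_zero_of_vanishing (fun j hj => (h j hj).1) hj fun _ _ => rfl,
    vectorField_eq_zero_of_vanishing (fun j hj => (h j hj).2) hj fun _ _ => rfl, add_zero]

theorem trivialCurrents_le (D : JetBox) : trivialCurrents D ≤ conservedCurrents D :=
  sup_le (vanishingCurrents_le D) fun _ hP => ⟨hP.1, fun j _ => hP.2 j (Set.mem_univ j)⟩

theorem V_le (D : JetBox) : V D ≤ conservedCurrents D := by
  rintro P ⟨hF, hG⟩
  refine ⟨⟨functionsOf_le hF, functionsOf_le hG⟩, fun j hj => ?_⟩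
  rw [divergence, totalXi_eq_of_mem (functionsOf_le hF) hj,
    totalEta_eq_of_mem (functionsOf_le hG) hj, solXi_eq_zero hF (by simp) ?_,
    solEta_eq_zero hG eta_notMem_rightCoords w_notMem_rightCoords]
  · exact add_zero _
  · rintro k (h | ⟨l, hl, h⟩)
    · simp at h
    · simp at h
      omega

/-- The divergence is the commutator of the total derivatives applied to H. -/
theorem curl_mem_nullDivergences {H : D.points → ℝ} (hH : H ∈ differentialFunctions D) :
    (totalEta H, -totalXi H) ∈ nullDivergences D := by
  have h1 : totalXi H ∈ differentialFunctions D := by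
    rw [totalXi_eq_vectorField hH]
    exact vectorField_mem_differentialFunctions coeffXi_mem hH
  have h2 : totalEta H ∈ differentialFunctions D := by
    rw [totalEta_eq_vectorField hH]
    exact vectorField_mem_differentialFunctions coeffEta_mem hH
  refine ⟨⟨h2, neg_mem h1⟩, fun j _ => ?_⟩
  rw [divergence, totalXi_totalEta_comm hH, ← neg_one_smul ℝ (totalXi H), totalEta_smul _ h1]
  ring

/-- On solutions the restricted curl coincides with the full one, so their difference is a vanishing
current. -/
theorem solCurl_mem_trivialCurrents {H : D.points → ℝ} (hH : H ∈ differentialFunctions D) :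
    (vectorField solCoeffEta H, -vectorField solCoeffXi H) ∈ trivialCurrents D := by
  have h1 := curl_mem_nullDivergences hH
  refine (Submodule.sub_mem_iff_left _ (Submodule.mem_sup_right h1)).1
    (Submodule.mem_sup_left ?_)
  refine ⟨sub_mem ⟨solEta_mem hH, neg_mem (solXi_mem hH)⟩ h1.1, fun j hj => ⟨?_, ?_⟩⟩
  · simp [totalEta_eq_of_mem hH hj]
  · simp [totalXi_eq_of_mem hH hj]

/-- Every conserved current is equivalent to a pair in `V`. -/
theorem exists_sub_mem_trivialCurrents {P : (D.points → ℝ) × (D.points → ℝ)}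
    (hP : P ∈ conservedCurrents D) : ∃ Q ∈ V D, P - Q ∈ trivialCurrents D := by
  obtain ⟨F, G⟩ := P
  obtain ⟨⟨hF, hG⟩, -⟩ := id hP
  set F₀ : D.points → ℝ := fun j => F (freeze pureCoordsᶜ j) with hF₀def
  set G₀ : D.points → ℝ := fun j => G (freeze pureCoordsᶜ j) with hG₀def
  have hF₀ : F₀ ∈ functionsOf D pureCoords := comp_freeze_mem_pureCoords hF
  have hG₀ : G₀ ∈ functionsOf D pureCoords := comp_freeze_mem_pureCoords hG
  have hvan : (F - F₀, G - G₀) ∈ vanishingCurrents D := by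
    refine ⟨⟨sub_mem hF (functionsOf_le hF₀), sub_mem hG (functionsOf_le hG₀)⟩, fun j hj => ?_⟩
    simp [hF₀def, hG₀def, freeze_eq_self hj]
  have hcons : (F₀, G₀) ∈ conservedCurrents D := by
    have := sub_mem hP (vanishingCurrents_le D hvan)
    simpa using this
  obtain ⟨m₁, hm₁⟩ := exists_mem_pureCoordsLE hF₀
  obtain ⟨m₂, hm₂⟩ := exists_mem_pureCoordsLE hG₀
  have hFm := functionsOf_mono (pureCoordsLE_mono (le_max_left m₁ m₂)) hm₁
  have hGm := functionsOf_mono (pureCoordsLE_mono (le_max_right m₁ m₂)) hm₂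
  -- The left side is a function of unmixed coordinates, which are unconstrained on solutions, so
  -- vanishing there means vanishing identically.
  have hdiv : vectorField solCoeffXi F₀ + vectorField solCoeffEta G₀ = 0 := by
    refine eq_zero_of_vanishing (add_mem
      (functionsOf_mono (pureCoordsLE_subset _) (solXi_mem_pureCoordsLE hFm))
      (functionsOf_mono (pureCoordsLE_subset _) (solEta_mem_pureCoordsLE hGm))) fun j hj => ?_
    have := hcons.2 j hj
    rwa [divergence, totalXi_eq_of_mem (functionsOf_le hF₀) hj,
      totalEta_eq_of_mem (functionsOf_le hG₀) hj] at this
  obtain ⟨H, hH, h1, h2⟩ := exists_potential _ hFm hGm hdiv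
  refine ⟨(F₀ + vectorField solCoeffEta H, G₀ - vectorField solCoeffXi H), ⟨h1, h2⟩, ?_⟩
  have h3 : _ ∈ trivialCurrents D := sub_mem (Submodule.mem_sup_left hvan)
    (solCurl_mem_trivialCurrents (functionsOf_le hH))
  convert h3 using 1
  refine Prod.ext ?_ ?_
  · change F - (F₀ + _) = F - F₀ - _
    abel
  · change G - (G₀ - _) = G - G₀ - -_
    abel

end LightConeWave

/-! ### The isomorphism -/

/-- The pairs in `V` are conserved currents and all trivial currents are conserved, and sending the
class of a pair in `V` to the conservation law that it represents is a well-defined linear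
isomorphism from `V / V₀` onto the space of conservation laws. -/
theorem mainTheorem1 (D : LightConeWave.JetBox) :
    LightConeWave.trivialCurrents D ≤ LightConeWave.conservedCurrents D ∧
    ∃ hV : LightConeWave.V D ≤ LightConeWave.conservedCurrents D,
      ∃ Φ : (LightConeWave.V D ⧸ LightConeWave.V₀ D) ≃ₗ[ℝ] LightConeWave.ConservationLaws D,
        ∀ P : LightConeWave.V D,
          Φ (Submodule.Quotient.mk P) = Submodule.Quotient.mk (Submodule.inclusion hV P) := by
  refine ⟨LightConeWave.trivialCurrents_le D, LightConeWave.V_le D, ?_⟩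
  -- Both submodules consist of the trivial currents in the respective space, so the map is well
  -- defined and injective by definition; only surjectivity needs the potential.
  let φ := (LightConeWave.V₀ D).mapQ
    ((LightConeWave.trivialCurrents D).submoduleOf (LightConeWave.conservedCurrents D))
    (Submodule.inclusion (LightConeWave.V_le D)) fun _ h => h
  refine ⟨LinearEquiv.ofBijective φ ⟨?_, ?_⟩, fun P => rfl⟩
  · refine (injective_iff_map_eq_zero φ).2 fun x hx => ?_
    obtain ⟨P, rfl⟩ := Submodule.Quotient.mk_surjective _ x
    refine (Submodule.Quotient.mk_eq_zero _).2 ?_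
    exact (Submodule.Quotient.mk_eq_zero ((LightConeWave.trivialCurrents D).submoduleOf
      (LightConeWave.conservedCurrents D))).1 hx
  · intro y
    obtain ⟨P, rfl⟩ := Submodule.Quotient.mk_surjective _ y
    obtain ⟨Q, hQ, hPQ⟩ := LightConeWave.exists_sub_mem_trivialCurrents P.2
    refine ⟨Submodule.Quotient.mk ⟨Q, hQ⟩, Eq.symm ?_⟩
    exact (Submodule.Quotient.eq ((LightConeWave.trivialCurrents D).submoduleOf
      (LightConeWave.conservedCurrents D))).2 hPQ

end
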